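/- **Theorem.** The Euler graph is the Bratteli diagram whose vertices at level $n\ge 0$ are $(n,k)$, $0\le k\le n$, with $k+1$ edges from $(n,k)$ to $(n+1,k)$, $n-k+1$ edges from $(n,k)$ to $(n+1,k+1)$, and no other edges. Let $X$ be the space of infinite edge paths $\gamma=\gamma_0\gamma_1\dots$ from the root $(0,0)$, with the $\sigma$-algebra generated by the cylinder sets. Order the edges with a common range from left to right (the edges into $(n+1,k)$ coming from $(n,k-1)$ precede those coming from $(n,k)$), and for paths $\gamma,\xi$ that agree from some level on put $\gamma<\xi$ if $\gamma_n<\xi_n$ at the last edge where they differ. Let $T:X\to X$ be the Euler adic: $T\gamma$ is the smallest path larger than $\gamma$ if such a path exists; the remaining paths are the paths $\gamma^k_{\max}$ $(0\le k\le\infty)$ all of whose edges are maximal, passing through the vertices $(n,\min(n,k))$, and with $\gamma^k_{\min}$ the path of minimal edges through the vertices $(n,\max(n-k,0))$, one puts $T\gamma^k_{\max}=\gamma^k_{\min}$ for $0<k<\infty$, $T\gamma^0_{\max}=\gamma^\infty_{\min}$ and $T\gamma^\infty_{\max}=\gamma^0_{\min}$. Let $\eta$ be the symmetric measure, i.e.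 the Borel probability measure on $X$ giving weight $1/(n+2)$ to each edge from level $n$ to level $n+1$ (so each cylinder fixing the first $n$ edges has measure $1/(n+1)!$). Then $(X,T,\eta)$ is totally ergodic: for every $n\ge 1$ the map $T^n$ is an ergodic measure-preserving transformation of $(X,\eta)$, and no root of unity other than $1$ is an eigenvalue of $T$, that is, if $z\in\mathbb C$ is a root of unity and $f:X\to\mathbb C$ is measurable, not $\eta$-almost everywhere zero, and satisfies $f\circ T=zf$ $\eta$-almost everywhere, then $z=1$. -/

import Mathlib

open MeasureTheory

namespace EulerAdic

/-- The number of edges of the Euler graph from the vertex `(n, k)` to the vertex `(n + 1, l)`: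
`k + 1` if `l = k`, `n - k + 1` if `l = k + 1`, and none otherwise. Only used for `k ≤ n`. -/
def mult (n k l : ℕ) : ℕ :=
  if l = k then k + 1 else if l = k + 1 then n + 1 - k else 0

/-- The edges of the Euler graph from level `n` (vertices `(n, k)`, `0 ≤ k ≤ n`) to level `n + 1`
(vertices `(n + 1, l)`, `0 ≤ l ≤ n + 1`). Parallel edges are numbered from left to right. -/
@[ext]
structure Edge (n : ℕ) where
  source : Fin (n + 1)
  target : Fin (n + 2)
  index : ℕ
  index_lt : index < mult n source target

instance (n : ℕ) : MeasurableSpace (Edge n) := ⊤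

/-- The space `X` of infinite edge paths of the Euler graph that start at the root `(0, 0)`. -/
def Path : Type := {γ : ∀ n, Edge n // ∀ n, (γ n).target = (γ (n + 1)).source}

/-- The σ-algebra on `X` generated by the cylinder sets. -/
instance : MeasurableSpace Path :=
  inferInstanceAs (MeasurableSpace {γ : ∀ n, Edge n // ∀ n, (γ n).target = (γ (n + 1)).source})

/-- The strict order on edges with the same range: edges increase from left to right, that is,
first by source and then, among parallel edges, by number. -/
def Edge.Less {n : ℕ} (e f : Edge n) : Prop :=
  e.target = f.target ∧ (e.source < f.source ∨ (e.source = f.source ∧ e.index < f.index))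

/-- The induced partial order on paths: `γ < ξ` if they agree from some level on and, at the last
edge where they differ, the edge of `γ` is smaller. -/
def Path.Less (γ ξ : Path) : Prop :=
  ∃ n, (γ.1 n).Less (ξ.1 n) ∧ ∀ m, n < m → γ.1 m = ξ.1 m

/-- `ξ` is the successor of `γ`: the smallest path that is larger than `γ`. -/
def IsSuccessor (γ ξ : Path) : Prop :=
  γ.Less ξ ∧ ∀ ζ : Path, γ.Less ζ → ζ = ξ ∨ ξ.Less ζ

/-- The maximal path `γ^k_max`, `k < ∞`: it follows the right side of the graph down to `(k, k)`
and then passes through the vertices `(n, k)`, always along maximal edges. -/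
def maxPath (k : ℕ) : Path :=
  ⟨fun n =>
    { source := ⟨min n k, by omega⟩
      target := ⟨min (n + 1) k, by omega⟩
      index := if n < k then 0 else k
      index_lt := by
        simp only [mult]
        split_ifs <;> omega },
   fun _ => rfl⟩

/-- The minimal path `γ^k_min`, `k < ∞`: it follows the left side of the graph down to `(k, 0)`
and then passes through the vertices `(n, n - k)`, always along minimal edges. -/
def minPath (k : ℕ) : Path :=
  ⟨fun n =>
    { source := ⟨n - k, by omega⟩
      target := ⟨n + 1 - k, by omega⟩
      index := 0
      index_lt := by
        simp only [mult]
        split_ifs <;> omega },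
   fun _ => rfl⟩

/-- The minimal path `γ^∞_min` through the vertices `(n, 0)`. -/
def minPathTop : Path :=
  ⟨fun n =>
    { source := ⟨0, by omega⟩
      target := ⟨0, by omega⟩
      index := 0
      index_lt := by simp [mult] },
   fun _ => rfl⟩

open Classical in
/-- The Euler adic (Bratteli-Vershik) transformation `T`. A path with a successor is mapped to it.
The paths without successor are the maximal paths `γ^k_max`, `k = 0, 1, …, ∞`, and there
`T γ^k_max = γ^k_min` for `0 < k < ∞`, `T γ^0_max = γ^∞_min` and `T γ^∞_max = γ^0_min`
(the last case below). -/
noncomputable def T (γ : Path) : Path :=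
  if h : ∃ ξ, IsSuccessor γ ξ then h.choose
  else if h : ∃ k : ℕ, 0 < k ∧ γ = maxPath k then minPath h.choose
  else if γ = maxPath 0 then minPathTop
  else minPath 0

/-- The `n + 2` edges that leave the vertex `(n, k)`, enumerated by `Fin (n + 2)`: first the
`k + 1` edges to `(n + 1, k)`, then the `n - k + 1` edges to `(n + 1, k + 1)`. -/
def outEdge (n : ℕ) (k : Fin (n + 1)) (i : Fin (n + 2)) : Edge n :=
  if h : (i : ℕ) ≤ k then
    { source := k
      target := k.castSucc
      index := i
      index_lt := by simp [mult]; omega }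
  else
    { source := k
      target := k.succ
      index := i - (k + 1)
      index_lt := by simp [mult]; omega }

theorem outEdge_source (n : ℕ) (k : Fin (n + 1)) (i : Fin (n + 2)) :
    (outEdge n k i).source = k := by
  unfold outEdge; split_ifs <;> rfl

/-- The vertex reached at level `n` when the edges are chosen according to `ω`. -/
def vertexOf (ω : ∀ n, Fin (n + 2)) : ∀ n, Fin (n + 1)
  | 0 => 0
  | n + 1 => (outEdge n (vertexOf ω n) (ω n)).target

/-- The path that starts at the root and leaves level `n` along the outgoing edge number `ω n`. -/
def pathOf (ω : ∀ n, Fin (n + 2)) : Path :=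
  ⟨fun n => outEdge n (vertexOf ω n) (ω n), fun n => (outEdge_source (n + 1) _ _).symm⟩

/-- The symmetric measure `η` on `X`: every edge from level `n` to level `n + 1` has weight
`1 / (n + 2)`, that is, `η` is the law of the random path which leaves each vertex along a
uniformly chosen outgoing edge, independently at the different levels. Equivalently
(`eta_cylinder`), every cylinder set given by the first `n` edges has measure `1 / (n + 1)!`. -/
noncomputable def eta : Measure Path :=
  (Measure.infinitePi fun n : ℕ => (PMF.uniformOfFintype (Fin (n + 2))).toMeasure).map pathOf

theorem measurable_vertexOf (n : ℕ) : Measurable fun ω => vertexOf ω n := by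
  induction n with
  | zero => exact measurable_const
  | succ n ih =>
    exact (measurable_of_countable
      (fun p : Fin (n + 1) × Fin (n + 2) => (outEdge n p.1 p.2).target)).comp
      (ih.prodMk (measurable_pi_apply n))

theorem measurable_pathOf : Measurable pathOf := by
  refine Measurable.subtype_mk (measurable_pi_lambda _ fun n => ?_)
  exact (measurable_of_countable
    (fun p : Fin (n + 1) × Fin (n + 2) => outEdge n p.1 p.2)).comp
    ((measurable_vertexOf n).prodMk (measurable_pi_apply n))

instance : IsProbabilityMeasure eta :=
  Measure.isProbabilityMeasure_map measurable_pathOf.aemeasurable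

/-- The position of an edge among the edges that leave its source. -/
def Edge.label {n : ℕ} (e : Edge n) : Fin (n + 2) :=
  if e.target.val = e.source.val then Fin.ofNat (n + 2) e.index
  else Fin.ofNat (n + 2) (e.source + 1 + e.index)

theorem outEdge_eq_iff {n : ℕ} (e : Edge n) (i : Fin (n + 2)) :
    outEdge n e.source i = e ↔ i = e.label := by
  obtain ⟨s, t, x, hx⟩ := e
  have hs := s.2
  have hi := i.2
  have hm := hx
  simp only [mult] at hm
  simp only [outEdge, Edge.label]
  split_ifs at hm with h1 h2
  · have hx' : x < n + 2 := by omega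
    simp only [h1, if_true, Fin.ext_iff, Fin.ofNat, Nat.mod_eq_of_lt hx']
    split_ifs with h <;> simp only [Edge.mk.injEq, Fin.ext_iff, Fin.val_castSucc, Fin.val_succ, true_and] <;>
      omega
  · have hx' : s + 1 + x < n + 2 := by omega
    simp only [h1, if_false, Fin.ext_iff, Fin.ofNat, Nat.mod_eq_of_lt hx']
    split_ifs with h <;> simp only [Edge.mk.injEq, Fin.ext_iff, Fin.val_castSucc, Fin.val_succ, true_and] <;>
      omega
  · omega

theorem agree_iff (ω : ∀ n, Fin (n + 2)) (ξ : Path) (n : ℕ) :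
    (∀ i < n, (pathOf ω).1 i = ξ.1 i) ↔ ∀ i < n, ω i = (ξ.1 i).label := by
  have key : (∀ i < n, ω i = (ξ.1 i).label) ∨ (∀ i < n, (pathOf ω).1 i = ξ.1 i) →
      vertexOf ω n = (ξ.1 n).source ∧ ∀ i < n, (pathOf ω).1 i = ξ.1 i ∧ ω i = (ξ.1 i).label := by
    induction n with
    | zero => exact fun _ => ⟨Subsingleton.elim (α := Fin 1) _ _, by simp⟩
    | succ n ih =>
      intro h
      obtain ⟨hv, hr⟩ := ih (h.imp (fun h i hi => h i (by omega)) (fun h i hi => h i (by omega)))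
      have h0 : (pathOf ω).1 n = outEdge n (ξ.1 n).source (ω n) := by rw [← hv]; rfl
      have h1 : (pathOf ω).1 n = ξ.1 n ∧ ω n = (ξ.1 n).label := by
        have := outEdge_eq_iff (ξ.1 n) (ω n)
        rw [h0, this, and_self]
        rcases h with h | h
        · exact h n (by omega)
        · exact this.1 (h0 ▸ h n (by omega))
      refine ⟨?_, fun i hi => ?_⟩
      · rw [← ξ.2 n, ← h1.1]; rfl
      · rcases Nat.lt_succ_iff_lt_or_eq.1 hi with hi | rfl
        · exact hr i hi
        · exact h1
  exact ⟨fun h i hi => ((key (Or.inr h)).2 i hi).2, fun h i hi => ((key (Or.inl h)).2 i hi).1⟩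

/-- Every cylinder set given by `n` initial edges has measure `1 / (n + 1)!`. -/
theorem eta_cylinder (ξ : Path) (n : ℕ) :
    eta {γ | ∀ i < n, γ.1 i = ξ.1 i} = ((n + 1).factorial : ENNReal)⁻¹ := by
  have hm : MeasurableSet {γ : Path | ∀ i < n, γ.1 i = ξ.1 i} := by
    simp only [Set.ofPred_forall]
    refine MeasurableSet.iInter fun i => MeasurableSet.iInter fun _ => ?_
    exact ((measurable_pi_apply i).comp measurable_subtype_coe)
      (MeasurableSpace.measurableSet_top (s := {ξ.1 i}))
  rw [eta, Measure.map_apply measurable_pathOf hm]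
  have : pathOf ⁻¹' {γ : Path | ∀ i < n, γ.1 i = ξ.1 i} =
      Set.pi (Finset.range n) fun i => {(ξ.1 i).label} := by
    ext ω
    simpa [Set.mem_pi] using agree_iff ω ξ n
  rw [this, Measure.infinitePi_pi _ (fun i _ => measurableSet_singleton _)]
  clear this hm
  induction n with
  | zero => simp
  | succ n ih =>
    rw [Finset.prod_range_succ, ih, PMF.toMeasure_apply_singleton _ _ (measurableSet_singleton _),
      PMF.uniformOfFintype_apply, Fintype.card_fin, Nat.factorial_succ (n + 1), mul_comm,
      Nat.cast_mul, ENNReal.mul_inv (by simp) (by simp)]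

/-- `z` is an eigenvalue of the transformation `S` of the measure space `(Ω, μ)`: there is a
measurable complex function `f`, not almost everywhere zero, with `f ∘ S = z f` almost everywhere.
(Every square-integrable eigenfunction is of this kind.) -/
def IsEigenvalue {Ω : Type*} [MeasurableSpace Ω] (S : Ω → Ω) (μ : Measure Ω) (z : ℂ) : Prop :=
  ∃ f : Ω → ℂ, AEStronglyMeasurable f μ ∧ ¬ (f =ᵐ[μ] 0) ∧ (fun x => f (S x)) =ᵐ[μ] fun x => z * f x

end EulerAdic

/-! Number the paths from the root to a vertex (n, k) in the adic order, from 0 to `eul n k - 1`;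
this number is the `rank` of an initial segment. While the edges from level n on stay fixed, T adds
one to the rank, so a power of T becomes addition of a constant (`T_iterate_eq_of_rank`).

Ergodicity of T: for an invariant set A, the measure of A in a cylinder depends only on the end
vertex and obeys a recurrence (`cylMeasure_succ`). Comparing neighbouring vertices ever deeper in
the graph shows that it depends only on the level (`abs_cylMeasure_sub_le`). Hence A is independent
of every cylinder, so of itself, and has measure 0 or 1.

Powers of T: replacing the edge that leaves (n, k) by the q-th next parallel edge raises the rank by
q times `eul n k`, so it is a power of T (`edgeRot_eq_iterate`). If n + 1 is a power of a prime p,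
every Eulerian number `eul n k` with k ≤ n is 1 modulo p (`eul_modEq_one`), so for a set A invariant
under T^(pq) this move acts like T^q. But it leaves the first n edges alone and, made cyclic,
preserves `eta`; it is unavailable only on a set of measure at most 2q / (n + 2). As j grows in n +
1 = p^j, A and its preimage under T^q get equal measure in each cylinder, so they agree almost
everywhere. Ergodicity thus passes from T^q to T^(pq), and induction over prime factors gives all
powers. An eigenfunction for z with z^m = 1 is invariant under T^m, hence constant, which forces z =
1. -/

namespace EulerAdic

/-! ### Paths in coordinates -/

/-- The number `k` of the vertex `(n, k)` that a path visits at level `n`. -/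
def Path.vertex (γ : Path) (n : ℕ) : ℕ := (γ.1 n).source

/-- The number of the `n`-th edge of a path among the edges parallel to it. -/
def Path.index (γ : Path) (n : ℕ) : ℕ := (γ.1 n).index

theorem Path.target_eq (γ : Path) (n : ℕ) : ((γ.1 n).target : ℕ) = γ.vertex (n + 1) := by
  rw [γ.2 n]; rfl

theorem Path.vertex_le (γ : Path) (n : ℕ) : γ.vertex n ≤ n := by
  have := (γ.1 n).source.2
  simp only [Path.vertex]; omega

theorem Path.vertex_zero (γ : Path) : γ.vertex 0 = 0 := by
  have := γ.vertex_le 0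
  omega

theorem Path.index_lt (γ : Path) (n : ℕ) :
    γ.index n < mult n (γ.vertex n) (γ.vertex (n + 1)) := by
  rw [← γ.target_eq]; exact (γ.1 n).index_lt

theorem mult_self (n k : ℕ) : mult n k k = k + 1 := by simp [mult]

theorem mult_succ (n k : ℕ) : mult n k (k + 1) = n + 1 - k := by simp [mult]

theorem Path.vertex_succ (γ : Path) (n : ℕ) :
    γ.vertex (n + 1) = γ.vertex n ∨ γ.vertex (n + 1) = γ.vertex n + 1 := by
  have := γ.index_lt n
  simp only [mult] at this
  split_ifs at this <;> omega

theorem Path.edge_eq_iff (γ ξ : Path) (n : ℕ) : γ.1 n = ξ.1 n ↔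
    γ.vertex n = ξ.vertex n ∧ γ.vertex (n + 1) = ξ.vertex (n + 1) ∧ γ.index n = ξ.index n := by
  rw [Edge.ext_iff, Fin.ext_iff, Fin.ext_iff, γ.target_eq, ξ.target_eq]; rfl

theorem Path.ext_edges {γ ξ : Path} (h : ∀ i, γ.1 i = ξ.1 i) : γ = ξ :=
  Subtype.ext (funext h)

theorem le_of_index_lt {v x : ℕ → ℕ} (h0 : v 0 = 0)
    (h : ∀ n, x n < mult n (v n) (v (n + 1))) (n : ℕ) : v n ≤ n := by
  induction n with
  | zero => omega
  | succ n ih =>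
    have := h n
    simp only [mult] at this
    split_ifs at this <;> omega

/-- The path with given vertices and edge numbers. -/
def Path.ofSeq (v x : ℕ → ℕ) (h0 : v 0 = 0) (h : ∀ n, x n < mult n (v n) (v (n + 1))) : Path :=
  ⟨fun n =>
    { source := ⟨v n, Nat.lt_succ_of_le (le_of_index_lt h0 h n)⟩
      target := ⟨v (n + 1), Nat.lt_succ_of_le (le_of_index_lt h0 h (n + 1))⟩
      index := x n
      index_lt := h n },
   fun _ => rfl⟩

theorem Path.vertex_ofSeq {v x : ℕ → ℕ} (h0 : v 0 = 0)
    (h : ∀ n, x n < mult n (v n) (v (n + 1))) (n : ℕ) : (ofSeq v x h0 h).vertex n = v n := rfl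

theorem Path.index_ofSeq {v x : ℕ → ℕ} (h0 : v 0 = 0)
    (h : ∀ n, x n < mult n (v n) (v (n + 1))) (n : ℕ) : (ofSeq v x h0 h).index n = x n := rfl

/-- The paths with the same first `n` edges as `ξ`. -/
def cyl (n : ℕ) (ξ : Path) : Set Path := {γ | ∀ i < n, γ.1 i = ξ.1 i}

theorem mem_cyl_self (n : ℕ) (ξ : Path) : ξ ∈ cyl n ξ := fun _ _ => rfl

theorem cyl_eq_of_mem {n : ℕ} {γ ξ : Path} (h : γ ∈ cyl n ξ) : cyl n γ = cyl n ξ := by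
  ext ζ
  exact ⟨fun hζ i hi => (hζ i hi).trans (h i hi), fun hζ i hi => (hζ i hi).trans (h i hi).symm⟩

theorem cyl_mono {m n : ℕ} (h : m ≤ n) (ξ : Path) : cyl n ξ ⊆ cyl m ξ :=
  fun _ hγ i hi => hγ i (hi.trans_le h)

theorem cyl_zero (ξ : Path) : cyl 0 ξ = Set.univ :=
  Set.eq_univ_of_forall fun _ _ hi => absurd hi (Nat.not_lt_zero _)

theorem vertex_eq_of_mem_cyl {n : ℕ} {γ ξ : Path} (h : γ ∈ cyl n ξ) {i : ℕ} (hi : i ≤ n) :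
    γ.vertex i = ξ.vertex i := by
  cases i with
  | zero => rw [γ.vertex_zero, ξ.vertex_zero]
  | succ i => exact ((γ.edge_eq_iff ξ i).1 (h i hi)).2.1

theorem index_eq_of_mem_cyl {n : ℕ} {γ ξ : Path} (h : γ ∈ cyl n ξ) {i : ℕ} (hi : i < n) :
    γ.index i = ξ.index i := ((γ.edge_eq_iff ξ i).1 (h i hi)).2.2

theorem mem_cyl_iff {n : ℕ} {γ ξ : Path} : γ ∈ cyl n ξ ↔
    (∀ i ≤ n, γ.vertex i = ξ.vertex i) ∧ ∀ i < n, γ.index i = ξ.index i :=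
  ⟨fun h => ⟨fun _ hi => vertex_eq_of_mem_cyl h hi, fun _ hi => index_eq_of_mem_cyl h hi⟩,
    fun h i hi => (γ.edge_eq_iff ξ i).2 ⟨h.1 i hi.le, h.1 (i + 1) hi, h.2 i hi⟩⟩

theorem mem_cyl_succ_iff {n : ℕ} {γ ξ : Path} : γ ∈ cyl (n + 1) ξ ↔
    γ ∈ cyl n ξ ∧ γ.vertex (n + 1) = ξ.vertex (n + 1) ∧ γ.index n = ξ.index n := by
  constructor
  · exact fun h => ⟨cyl_mono n.le_succ ξ h, vertex_eq_of_mem_cyl h le_rfl,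
      index_eq_of_mem_cyl h n.lt_succ_self⟩
  · rintro ⟨h, hv, hx⟩ i hi
    rcases Nat.lt_succ_iff_lt_or_eq.1 hi with hi | rfl
    · exact h i hi
    · exact (γ.edge_eq_iff ξ i).2 ⟨vertex_eq_of_mem_cyl h le_rfl, hv, hx⟩

/-- `γ` and `ξ` have the same edges from level `n` on. -/
def TailEq (n : ℕ) (γ ξ : Path) : Prop := ∀ i, n ≤ i → γ.1 i = ξ.1 i

theorem TailEq.symm {n : ℕ} {γ ξ : Path} (h : TailEq n γ ξ) : TailEq n ξ γ :=
  fun i hi => (h i hi).symm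

theorem TailEq.trans {n : ℕ} {γ ξ ζ : Path} (h : TailEq n γ ξ) (h' : TailEq n ξ ζ) :
    TailEq n γ ζ :=
  fun i hi => (h i hi).trans (h' i hi)

theorem TailEq.mono {m n : ℕ} (hmn : m ≤ n) {γ ξ : Path} (h : TailEq m γ ξ) : TailEq n γ ξ :=
  fun i hi => h i (hmn.trans hi)

theorem TailEq.vertex {n : ℕ} {γ ξ : Path} (h : TailEq n γ ξ) {i : ℕ} (hi : n ≤ i) :
    γ.vertex i = ξ.vertex i := ((γ.edge_eq_iff ξ i).1 (h i hi)).1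

theorem TailEq.index {n : ℕ} {γ ξ : Path} (h : TailEq n γ ξ) {i : ℕ} (hi : n ≤ i) :
    γ.index i = ξ.index i := ((γ.edge_eq_iff ξ i).1 (h i hi)).2.2

theorem TailEq.eq_of_mem_cyl {n : ℕ} {γ ξ : Path} (h : TailEq n γ ξ) (h' : γ ∈ cyl n ξ) :
    γ = ξ :=
  Path.ext_edges fun i => (lt_or_ge i n).elim (h' i) (h i)

/-- Two paths through the same vertex at level `n` can be spliced there. -/
theorem exists_splice {n : ℕ} {γ ξ : Path} (h : γ.vertex n = ξ.vertex n) :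
    ∃ ζ, ζ ∈ cyl n γ ∧ TailEq n ζ ξ := by
  let v : ℕ → ℕ := fun i => if i ≤ n then γ.vertex i else ξ.vertex i
  let x : ℕ → ℕ := fun i => if i < n then γ.index i else ξ.index i
  have hv : ∀ i, n ≤ i → v i = ξ.vertex i := by
    intro i hi
    simp only [v]
    split_ifs with h'
    · rw [le_antisymm h' hi, h]
    · rfl
  have hx : ∀ i, x i < mult i (v i) (v (i + 1)) := by
    intro i
    rcases lt_or_ge i n with hi | hi
    · simpa [x, v, hi, hi.le, Nat.succ_le_of_lt hi] using γ.index_lt i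
    · rw [hv i hi, hv (i + 1) (by omega)]
      simpa [x, hi.not_gt] using ξ.index_lt i
  have h0 : v 0 = 0 := by simp [v, γ.vertex_zero]
  refine ⟨Path.ofSeq v x h0 hx, mem_cyl_iff.2 ⟨fun i hi => ?_, fun i hi => ?_⟩, fun i hi => ?_⟩
  · simp [Path.vertex_ofSeq, v, hi]
  · simp [Path.index_ofSeq, x, hi]
  · rw [Path.edge_eq_iff, Path.vertex_ofSeq, Path.vertex_ofSeq, Path.index_ofSeq, hv i hi,
      hv (i + 1) (by omega)]
    simp [x, hi.not_gt]

/-- A path can leave the vertex at level `n` along any edge. -/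
theorem exists_extend {n l x : ℕ} (γ : Path) (h : x < mult n (γ.vertex n) l) :
    ∃ ζ, ζ ∈ cyl n γ ∧ ζ.vertex (n + 1) = l ∧ ζ.index n = x := by
  let v : ℕ → ℕ := fun i => if i ≤ n then γ.vertex i else l
  let y : ℕ → ℕ := fun i => if i < n then γ.index i else if i = n then x else 0
  have hx : ∀ i, y i < mult i (v i) (v (i + 1)) := by
    intro i
    rcases lt_trichotomy i n with hi | rfl | hi
    · simpa [y, v, hi, hi.le, Nat.succ_le_of_lt hi] using γ.index_lt i
    · simpa [y, v] using h
    · simp [y, v, hi.not_gt, hi.not_ge, hi.ne', show ¬ i + 1 ≤ n by omega, mult]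
  have h0 : v 0 = 0 := by simp [v, γ.vertex_zero]
  refine ⟨Path.ofSeq v y h0 hx, mem_cyl_iff.2 ⟨fun i hi => ?_, fun i hi => ?_⟩, ?_, ?_⟩
  · simp [Path.vertex_ofSeq, v, hi]
  · simp [Path.index_ofSeq, y, hi]
  · simp [Path.vertex_ofSeq, v]
  · simp [Path.index_ofSeq, y]

/-! ### Path counts and ranks -/

/-- The number of paths from the root to the vertex `(n, k)`, an Eulerian number. -/
def eul : ℕ → ℕ → ℕ
  | 0, 0 => 1
  | 0, _ + 1 => 0
  | n + 1, 0 => eul n 0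
  | n + 1, k + 1 => (n + 1 - k) * eul n k + (k + 2) * eul n (k + 1)

/-- The number of paths from the root to the vertex `(n + 1, k)` through `(n, k - 1)`. -/
def leftCount (n : ℕ) : ℕ → ℕ
  | 0 => 0
  | k + 1 => (n + 1 - k) * eul n k

theorem eul_succ (n k : ℕ) : eul (n + 1) k = leftCount n k + (k + 1) * eul n k := by
  cases k <;> simp [eul, leftCount]

theorem eul_pos {n k : ℕ} (h : k ≤ n) : 0 < eul n k := by
  induction n generalizing k with
  | zero => obtain rfl : k = 0 := by omega
            simp [eul]
  | succ n ih =>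
    cases k with
    | zero => exact ih (Nat.zero_le _)
    | succ k =>
      have := Nat.mul_pos (show 0 < n + 1 - k by omega) (ih (show k ≤ n by omega))
      simp only [eul]; omega

theorem eul_eq_zero {n k : ℕ} (h : n < k) : eul n k = 0 := by
  induction n generalizing k with
  | zero => cases k with
    | zero => omega
    | succ k => rfl
  | succ n ih =>
    cases k with
    | zero => omega
    | succ k => simp [eul, ih (show n < k by omega), ih (show n < k + 1 by omega)]

/-- The rank of the initial segment of length `n` among all segments with the same end. -/
def rank (γ : Path) : ℕ → ℕ
  | 0 => 0
  -- Each parallel edge carries a block of `eul n k` segments. An edge that keeps k comes from the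
  -- right-hand source, so all segments through (n, k - 1) precede it.
  | n + 1 => rank γ n + γ.index n * eul n (γ.vertex n) +
      if γ.vertex (n + 1) = γ.vertex n then leftCount n (γ.vertex n) else 0

theorem rank_succ_of_eq {γ : Path} {n : ℕ} (h : γ.vertex (n + 1) = γ.vertex n) :
    rank γ (n + 1) =
      rank γ n + γ.index n * eul n (γ.vertex n) + leftCount n (γ.vertex n) := by
  simp [rank, h]

theorem rank_succ_of_ne {γ : Path} {n : ℕ} (h : γ.vertex (n + 1) = γ.vertex n + 1) :
    rank γ (n + 1) = rank γ n + γ.index n * eul n (γ.vertex n) := by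
  simp [rank, h]

theorem add_mul_lt {r x e m : ℕ} (hr : r < e) (hx : x < m) : r + x * e < m * e := by
  have : (x + 1) * e ≤ m * e := Nat.mul_le_mul_right e hx
  rw [Nat.succ_mul] at this
  omega

theorem rank_lt (γ : Path) (n : ℕ) : rank γ n < eul n (γ.vertex n) := by
  induction n with
  | zero => simp [rank, γ.vertex_zero, eul]
  | succ n ih =>
    have hx := γ.index_lt n
    rw [eul_succ]
    rcases γ.vertex_succ n with h | h
    · rw [rank_succ_of_eq h, h]
      rw [h, mult_self] at hx
      have := add_mul_lt ih hx
      omega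
    · rw [rank_succ_of_ne h, h]
      rw [h, mult_succ] at hx
      have := add_mul_lt ih hx
      simp only [leftCount]; omega

/-- Segments arriving from the left-hand source fill exactly the ranks below `leftCount`, so the
rank reveals the source of the last edge. -/
theorem rank_lt_leftCount {γ : Path} {n : ℕ} (h : γ.vertex (n + 1) = γ.vertex n + 1) :
    rank γ (n + 1) < leftCount n (γ.vertex (n + 1)) := by
  have hx := γ.index_lt n
  rw [rank_succ_of_ne h, h]
  rw [h, mult_succ] at hx
  exact add_mul_lt (rank_lt γ n) hx

theorem add_mul_inj {r x r' x' e : ℕ} (hr : r < e) (hr' : r' < e)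
    (h : r + x * e = r' + x' * e) : r = r' ∧ x = x' := by
  have he : 0 < e := by omega
  have h1 := congrArg (· % e) h
  have h2 := congrArg (· / e) h
  simp only [Nat.add_mul_mod_self_right, Nat.mod_eq_of_lt hr, Nat.mod_eq_of_lt hr'] at h1
  simp only [Nat.add_mul_div_right _ _ he, Nat.div_eq_of_lt hr, Nat.div_eq_of_lt hr'] at h2
  omega

/-- The threshold `leftCount` recovers the last source; division by the Eulerian number there then
separates the edge number (quotient) from the previous rank (remainder). -/
theorem mem_cyl_of_rank_eq {n : ℕ} {γ ξ : Path} (hv : γ.vertex n = ξ.vertex n)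
    (hr : rank γ n = rank ξ n) : γ ∈ cyl n ξ := by
  induction n with
  | zero => rw [cyl_zero]; trivial
  | succ n ih =>
    have h1 := rank_lt γ n
    have h2 := rank_lt ξ n
    have main : γ.vertex n = ξ.vertex n ∧ rank γ n = rank ξ n ∧ γ.index n = ξ.index n := by
      rcases γ.vertex_succ n with h | h <;> rcases ξ.vertex_succ n with h' | h'
      · have hh : γ.vertex n = ξ.vertex n := by omega
        rw [rank_succ_of_eq h, rank_succ_of_eq h', hh] at hr
        rw [hh] at h1
        exact ⟨hh, add_mul_inj h1 h2 (by omega)⟩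
      · have := rank_lt_leftCount h'
        rw [← hv, ← hr, rank_succ_of_eq h, h] at this
        omega
      · have := rank_lt_leftCount h
        rw [hv, hr, rank_succ_of_eq h', h'] at this
        omega
      · have hh : γ.vertex n = ξ.vertex n := by omega
        rw [rank_succ_of_ne h, rank_succ_of_ne h', hh] at hr
        rw [hh] at h1
        exact ⟨hh, add_mul_inj h1 h2 (by omega)⟩
    exact mem_cyl_succ_iff.2 ⟨ih main.1 main.2.1, hv, main.2.2⟩

theorem rank_eq_of_mem_cyl {n : ℕ} {γ ξ : Path} (h : γ ∈ cyl n ξ) : rank γ n = rank ξ n := by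
  induction n with
  | zero => rfl
  | succ n ih =>
    simp only [rank, ih (cyl_mono n.le_succ ξ h), vertex_eq_of_mem_cyl h n.le_succ,
      vertex_eq_of_mem_cyl h le_rfl, index_eq_of_mem_cyl h n.lt_succ_self]

/-- The same division with remainder, run backwards, builds a segment of any admissible rank. -/
theorem exists_rank {n l c : ℕ} (hl : l ≤ n) (hc : c < eul n l) :
    ∃ γ : Path, γ.vertex n = l ∧ rank γ n = c := by
  induction n generalizing l c with
  | zero =>
    obtain rfl : l = 0 := by omega
    simp only [eul] at hc
    exact ⟨minPathTop, Path.vertex_zero _, by simp only [rank]; omega⟩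
  | succ n ih =>
    rw [eul_succ] at hc
    by_cases h : c < leftCount n l
    · cases l with
      | zero => simp [leftCount] at h
      | succ l =>
        simp only [leftCount] at h
        have he := eul_pos (show l ≤ n by omega)
        obtain ⟨γ, hv, hr⟩ := ih (show l ≤ n by omega) (Nat.mod_lt c he)
        obtain ⟨ζ, hζ, hζv, hζx⟩ := exists_extend (n := n) (l := l + 1) (x := c / eul n l) γ
          (by rw [hv, mult_succ]; exact (Nat.div_lt_iff_lt_mul he).2 h)
        have hζ' : ζ.vertex n = l := (vertex_eq_of_mem_cyl hζ le_rfl).trans hv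
        refine ⟨ζ, hζv, ?_⟩
        rw [rank_succ_of_ne (by omega), rank_eq_of_mem_cyl hζ, hr, hζx, hζ']
        exact Nat.mod_add_div' c _
    · have hl' : l ≤ n := by
        by_contra hl'
        rw [eul_eq_zero (show n < l by omega)] at hc
        omega
      have he := eul_pos hl'
      obtain ⟨γ, hv, hr⟩ := ih hl' (Nat.mod_lt (c - leftCount n l) he)
      obtain ⟨ζ, hζ, hζv, hζx⟩ := exists_extend (n := n) (l := l)
        (x := (c - leftCount n l) / eul n l) γ
        (by rw [hv, mult_self]; exact (Nat.div_lt_iff_lt_mul he).2 (by omega))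
      have hζ' : ζ.vertex n = l := (vertex_eq_of_mem_cyl hζ le_rfl).trans hv
      refine ⟨ζ, hζv, ?_⟩
      rw [rank_succ_of_eq (by omega), rank_eq_of_mem_cyl hζ, hr, hζx, hζ', Nat.mod_add_div']
      omega

theorem exists_tailEq_rank {n c : ℕ} (γ : Path) (hc : c < eul n (γ.vertex n)) :
    ∃ ξ, TailEq n ξ γ ∧ rank ξ n = c := by
  obtain ⟨ζ, hv, hr⟩ := exists_rank (γ.vertex_le n) hc
  obtain ⟨ξ, hξ, ht⟩ := exists_splice hv
  exact ⟨ξ, ht, (rank_eq_of_mem_cyl hξ).trans hr⟩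

theorem TailEq.eq_of_rank_eq {n : ℕ} {γ ξ : Path} (h : TailEq n γ ξ) (hr : rank γ n = rank ξ n) :
    γ = ξ :=
  h.eq_of_mem_cyl (mem_cyl_of_rank_eq (h.vertex le_rfl) hr)

/-- Common edges add the same amount to both ranks, so the rank difference does not depend on the
level; the additive form avoids truncated subtraction. -/
theorem TailEq.rank_add {n m : ℕ} {γ ξ : Path} (h : TailEq n γ ξ) (hm : n ≤ m) :
    rank γ m + rank ξ n = rank ξ m + rank γ n := by
  induction m, hm using Nat.le_induction with
  | base => omega
  | succ m hm ih =>
    simp only [rank, h.vertex hm, h.vertex (show n ≤ m + 1 by omega), h.index hm]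
    omega

/-! ### The adic order -/

theorem rank_lt_of_edge_less {n : ℕ} {γ ξ : Path} (h : (γ.1 n).Less (ξ.1 n)) :
    rank γ (n + 1) < rank ξ (n + 1) := by
  obtain ⟨ht, hs⟩ := h
  replace ht : γ.vertex (n + 1) = ξ.vertex (n + 1) := by
    rw [← γ.target_eq, ← ξ.target_eq, ht]
  rw [Fin.ext_iff, Fin.lt_def] at hs
  change γ.vertex n < ξ.vertex n ∨ γ.vertex n = ξ.vertex n ∧ γ.index n < ξ.index n at hs
  rcases hs with hs | ⟨hs, hx⟩
  · have h1 := γ.vertex_succ n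
    have h2 := ξ.vertex_succ n
    have := rank_lt_leftCount (γ := γ) (n := n) (by omega)
    rw [ht, show ξ.vertex (n + 1) = ξ.vertex n by omega] at this
    rw [rank_succ_of_eq (γ := ξ) (by omega)]
    omega
  · have := add_mul_lt (rank_lt γ n) hx
    simp only [rank, ht, hs] at this ⊢
    omega

theorem rank_lt_of_less {n : ℕ} {γ ξ : Path} (ht : TailEq n γ ξ) (h : γ.Less ξ) :
    rank γ n < rank ξ n := by
  obtain ⟨m, hm, hm'⟩ := h
  have h1 := rank_lt_of_edge_less hm
  have hmn : m < n := by
    by_contra hmn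
    rw [ht m (by omega)] at hm
    obtain ⟨_, h | ⟨_, h⟩⟩ := hm <;> exact lt_irrefl _ h
  have := TailEq.rank_add (n := m + 1) (fun i hi => hm' i hi) (show m + 1 ≤ n from hmn)
  omega

theorem less_or_less {n : ℕ} {γ ξ : Path} (ht : TailEq n γ ξ) (hne : γ ≠ ξ) :
    γ.Less ξ ∨ ξ.Less γ := by
  induction n with
  | zero => exact absurd (Path.ext_edges fun i => ht i i.zero_le) hne
  | succ n ih =>
    by_cases h : γ.1 n = ξ.1 n
    · refine ih fun i hi => ?_
      rcases hi.eq_or_lt with rfl | hi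
      · exact h
      · exact ht i hi
    · have hv : (γ.1 n).target = (ξ.1 n).target := by rw [γ.2 n, ξ.2 n, ht (n + 1) le_rfl]
      rcases lt_trichotomy (γ.1 n).source (ξ.1 n).source with hs | hs | hs
      · exact Or.inl ⟨n, ⟨hv, Or.inl hs⟩, fun m hm => ht m hm⟩
      · rcases lt_trichotomy (γ.1 n).index (ξ.1 n).index with hx | hx | hx
        · exact Or.inl ⟨n, ⟨hv, Or.inr ⟨hs, hx⟩⟩, fun m hm => ht m hm⟩
        · exact absurd (Edge.ext hs hv hx) h
        · exact Or.inr ⟨n, ⟨hv.symm, Or.inr ⟨hs.symm, hx⟩⟩, fun m hm => (ht m hm).symm⟩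
      · exact Or.inr ⟨n, ⟨hv.symm, Or.inl hs⟩, fun m hm => (ht m hm).symm⟩

theorem less_iff_rank_lt {n : ℕ} {γ ξ : Path} (ht : TailEq n γ ξ) :
    γ.Less ξ ↔ rank γ n < rank ξ n := by
  refine ⟨rank_lt_of_less ht, fun h => ?_⟩
  rcases less_or_less ht (by rintro rfl; exact lt_irrefl _ h) with h' | h'
  · exact h'
  · exact absurd (rank_lt_of_less ht.symm h') h.not_gt

theorem Path.Less.exists_tailEq {γ ξ : Path} (h : γ.Less ξ) (n : ℕ) :
    ∃ m, n ≤ m ∧ TailEq m γ ξ := by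
  obtain ⟨m, _, hm⟩ := h
  exact ⟨max n (m + 1), le_max_left _ _, fun i hi => hm i (by omega)⟩

/-- A competitor may join the common tail only at a later level m. The rank difference is still one
there, which leaves no room between the two paths. -/
theorem isSuccessor_of_rank {n : ℕ} {γ ξ : Path} (ht : TailEq n ξ γ)
    (hr : rank ξ n = rank γ n + 1) : IsSuccessor γ ξ := by
  refine ⟨(less_iff_rank_lt ht.symm).2 (by omega), fun ζ hζ => ?_⟩
  obtain ⟨m, hm, htm⟩ := hζ.exists_tailEq n
  have h1 := rank_lt_of_less htm hζ
  have h2 := ht.rank_add hm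
  have h3 : TailEq m ξ ζ := (ht.mono hm).trans htm
  rcases eq_or_ne (rank ζ m) (rank ξ m) with h | h
  · exact Or.inl (h3.symm.eq_of_rank_eq h)
  · exact Or.inr ((less_iff_rank_lt h3).2 (by omega))

theorem IsSuccessor.unique {γ ξ ζ : Path} (h : IsSuccessor γ ξ) (h' : IsSuccessor γ ζ) :
    ξ = ζ := by
  rcases h.2 ζ h'.1 with h1 | h1
  · exact h1.symm
  · rcases h'.2 ξ h.1 with h2 | h2
    · exact h2
    · obtain ⟨m, _, hm⟩ := h1.exists_tailEq 0
      have := rank_lt_of_less hm h1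
      have := rank_lt_of_less hm.symm h2
      omega

theorem T_eq_of_rank {n : ℕ} {γ ξ : Path} (ht : TailEq n ξ γ) (hr : rank ξ n = rank γ n + 1) :
    T γ = ξ := by
  have h : ∃ ξ, IsSuccessor γ ξ := ⟨ξ, isSuccessor_of_rank ht hr⟩
  rw [T, dif_pos h]
  exact h.choose_spec.unique (isSuccessor_of_rank ht hr)

theorem T_iterate_eq_of_rank {n c : ℕ} {γ ξ : Path} (ht : TailEq n ξ γ)
    (hr : rank ξ n = rank γ n + c) : T^[c] γ = ξ := by
  induction c generalizing ξ with
  | zero => exact (ht.eq_of_rank_eq hr).symm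
  | succ c ih =>
    have hlt := rank_lt ξ n
    obtain ⟨ζ, hζ, hζr⟩ := exists_tailEq_rank (n := n) (c := rank γ n + c) ξ (by omega)
    rw [Function.iterate_succ_apply', ih (hζ.trans ht) hζr]
    exact T_eq_of_rank hζ.symm (by omega)

/-! ### Cylinders and measure-preserving maps -/

instance (n : ℕ) : Countable (Edge n) :=
  Function.Injective.countable (f := fun e : Edge n => (e.source, e.target, e.index))
    fun e f h => by simpa [Edge.ext_iff] using h

instance (n : ℕ) : DiscreteMeasurableSpace (Edge n) := ⟨fun _ => trivial⟩

/-- The initial segment of length `n` of a path. -/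
def initSeg (n : ℕ) (γ : Path) : ∀ i : Fin n, Edge i := fun i => γ.1 i

theorem measurable_edge (i : ℕ) : Measurable fun γ : Path => γ.1 i :=
  (measurable_pi_apply i).comp measurable_subtype_coe

theorem measurable_initSeg (n : ℕ) : Measurable (initSeg n) :=
  measurable_pi_lambda _ fun i => measurable_edge i

theorem initSeg_eq_iff {n : ℕ} {γ ξ : Path} : initSeg n γ = initSeg n ξ ↔ γ ∈ cyl n ξ := by
  simp [initSeg, funext_iff, cyl, Fin.forall_iff]

theorem preimage_initSeg (n : ℕ) (ξ : Path) : initSeg n ⁻¹' {initSeg n ξ} = cyl n ξ := by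
  ext γ
  simp [initSeg_eq_iff]

theorem measurableSet_cyl (n : ℕ) (ξ : Path) : MeasurableSet (cyl n ξ) := by
  rw [← preimage_initSeg]
  exact measurable_initSeg n (measurableSet_singleton _)

/-- A function of finitely many edges is measurable. -/
theorem measurable_of_cyl {β : Type*} [MeasurableSpace β] (n : ℕ) {f : Path → β}
    (hf : ∀ γ ξ, γ ∈ cyl n ξ → f γ = f ξ) : Measurable f := by
  intro s _
  have : f ⁻¹' s = initSeg n ⁻¹' (initSeg n '' (f ⁻¹' s)) := by
    refine (Set.subset_preimage_image _ _).antisymm ?_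
    rintro γ ⟨ξ, hξ, h⟩
    rw [Set.mem_preimage, hf γ ξ (initSeg_eq_iff.1 h.symm)]
    exact hξ
  rw [this]
  exact measurable_initSeg n (Set.to_countable _).measurableSet

theorem measurableSet_of_cyl (n : ℕ) {W : Set Path}
    (hW : ∀ γ ξ, γ ∈ cyl n ξ → (γ ∈ W ↔ ξ ∈ W)) : MeasurableSet W :=
  measurableSet_setOfPred.2 (measurable_of_cyl n fun γ ξ h => propext (hW γ ξ h))

/-- The cylinders of length at least `N`. -/
def cylinders (N : ℕ) : Set (Set Path) := {s | ∃ n ξ, N ≤ n ∧ s = cyl n ξ}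

theorem isPiSystem_cylinders (N : ℕ) : IsPiSystem (cylinders N) := by
  rintro _ ⟨n, ξ, hn, rfl⟩ _ ⟨m, ζ, hm, rfl⟩ ⟨γ, h1, h2⟩
  refine ⟨max n m, γ, hn.trans (le_max_left _ _), ?_⟩
  rw [← cyl_eq_of_mem h1, ← cyl_eq_of_mem h2]
  ext α
  refine ⟨fun h i hi => ?_, fun h => ⟨cyl_mono (le_max_left _ _) γ h,
    cyl_mono (le_max_right _ _) γ h⟩⟩
  rcases lt_max_iff.1 hi with hi | hi
  · exact h.1 i hi
  · exact h.2 i hi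

theorem measurableSet_generateFrom_cylinders (N : ℕ) {W : Set Path} (n : ℕ)
    (hW : ∀ γ ξ, γ ∈ cyl n ξ → (γ ∈ W ↔ ξ ∈ W)) :
    MeasurableSet[MeasurableSpace.generateFrom (cylinders N)] W := by
  have : W = ⋃ s : (∀ i : Fin (max n N), Edge i), {γ ∈ W | initSeg (max n N) γ = s} := by
    ext γ
    simp
  rw [this]
  refine @MeasurableSet.iUnion _ _ (MeasurableSpace.generateFrom (cylinders N)) _ _ fun s => ?_
  rcases Set.eq_empty_or_nonempty {γ ∈ W | initSeg (max n N) γ = s} with h | ⟨ξ, hξ, rfl⟩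
  · rw [h]
    exact @MeasurableSet.empty _ (MeasurableSpace.generateFrom (cylinders N))
  · refine MeasurableSpace.measurableSet_generateFrom ⟨max n N, ξ, le_max_right _ _, ?_⟩
    ext γ
    rw [Set.mem_ofPred_eq, initSeg_eq_iff]
    exact ⟨And.right, fun h => ⟨(hW γ ξ (cyl_mono (le_max_left _ _) ξ h)).2 hξ, h⟩⟩

/-- Discarding short cylinders costs nothing, since each is a countable union of long ones. This is
needed for maps that scramble the first N edges: only long cylinders are sure to have cylinders as
preimages. -/
theorem generateFrom_cylinders (N : ℕ) :
    (inferInstance : MeasurableSpace Path) = MeasurableSpace.generateFrom (cylinders N) := by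
  refine le_antisymm ?_ (MeasurableSpace.generateFrom_le ?_)
  · have : @Measurable _ _ (MeasurableSpace.generateFrom (cylinders N)) _
        (fun γ : Path => γ.1) := by
      refine @measurable_pi_lambda _ _ _ (MeasurableSpace.generateFrom (cylinders N)) _ _
        fun i s _ => measurableSet_generateFrom_cylinders N (i + 1) fun γ ξ h => ?_
      simp only [Set.mem_preimage, h i i.lt_succ_self]
    exact this.comap_le
  · rintro _ ⟨n, ξ, _, rfl⟩
    exact measurableSet_cyl n ξ

theorem measure_eq_of_cyl (N : ℕ) {μ ν : Measure Path} [IsFiniteMeasure μ]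
    (h : ∀ n ξ, N ≤ n → μ (cyl n ξ) = ν (cyl n ξ)) (huniv : μ Set.univ = ν Set.univ) : μ = ν := by
  refine ext_of_generate_finite _ (generateFrom_cylinders N) (isPiSystem_cylinders N) ?_ huniv
  rintro _ ⟨n, ξ, hn, rfl⟩
  exact h n ξ hn

theorem eta_cyl (n : ℕ) (ξ : Path) : eta (cyl n ξ) = ((n + 1).factorial : ENNReal)⁻¹ :=
  eta_cylinder ξ n

/-- A surjection which changes only the first `N` edges, and whose effect on them is injective and
depends only on them and the vertex at level `N`, preserves the measure. -/
theorem measurePreserving_of_tailEq (N : ℕ) {S : Path → Path} (hS : Function.Surjective S)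
    (ht : ∀ γ, TailEq N (S γ) γ)
    (hc : ∀ γ ξ, γ.vertex N = ξ.vertex N → (S γ ∈ cyl N (S ξ) ↔ γ ∈ cyl N ξ)) :
    MeasurePreserving S eta eta := by
  have key : ∀ n, N ≤ n → ∀ γ ξ, S γ ∈ cyl n (S ξ) ↔ γ ∈ cyl n ξ := by
    intro n hn γ ξ
    have aux : ∀ α β : Path, α ∈ cyl n β ↔
        α ∈ cyl N β ∧ ∀ i, N ≤ i → i < n → α.1 i = β.1 i := fun α β =>
      ⟨fun h => ⟨cyl_mono hn β h, fun i _ hi => h i hi⟩, fun h i hi =>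
        (lt_or_ge i N).elim (h.1 i) fun h' => h.2 i h' hi⟩
    have aux2 : (∀ i, N ≤ i → i < n → (S γ).1 i = (S ξ).1 i) ↔
        ∀ i, N ≤ i → i < n → γ.1 i = ξ.1 i :=
      forall₂_congr fun i hi => by rw [ht γ i hi, ht ξ i hi]
    by_cases hv : γ.vertex N = ξ.vertex N
    · rw [aux, aux, aux2, hc γ ξ hv]
    · refine iff_of_false (fun h => hv ?_) fun h => hv (vertex_eq_of_mem_cyl h hn)
      rw [← (ht γ).vertex le_rfl, ← (ht ξ).vertex le_rfl]
      exact vertex_eq_of_mem_cyl h hn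
  -- By surjectivity the preimage of a cylinder is a cylinder of the same length, and `eta` depends
  -- only on the length.
  have hpre : ∀ n ξ, N ≤ n → ∃ ζ, S ⁻¹' cyl n ξ = cyl n ζ := by
    intro n ξ hn
    obtain ⟨ζ, rfl⟩ := hS ξ
    exact ⟨ζ, Set.ext fun γ => key n hn γ ζ⟩
  have hm : Measurable S := by
    have : @Measurable _ _ _ (MeasurableSpace.generateFrom (cylinders N)) S := by
      refine measurable_generateFrom ?_
      rintro _ ⟨n, ξ, hn, rfl⟩
      obtain ⟨ζ, hζ⟩ := hpre n ξ hn
      rw [hζ]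
      exact measurableSet_cyl n ζ
    rwa [← generateFrom_cylinders N] at this
  have : IsProbabilityMeasure (eta.map S) := Measure.isProbabilityMeasure_map hm.aemeasurable
  refine ⟨hm, measure_eq_of_cyl N (fun n ξ hn => ?_) (by simp)⟩
  obtain ⟨ζ, hζ⟩ := hpre n ξ hn
  rw [Measure.map_apply hm (measurableSet_cyl n ξ), hζ, eta_cyl, eta_cyl]

/-- A set on which the first `n` edges determine the next one has measure at most `1 / (n + 2)`. -/
theorem measure_le_of_determined (n : ℕ) {W : Set Path}
    (hW : ∀ γ ∈ W, ∀ ξ ∈ W, γ ∈ cyl n ξ → γ.1 n = ξ.1 n) :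
    eta W ≤ ((n : ENNReal) + 2)⁻¹ := by
  let D : (∀ i : Fin n, Edge i) → Set Path := fun s => initSeg n ⁻¹' {s}
  have hD : ∀ s, MeasurableSet (D s) := fun s => measurable_initSeg n (measurableSet_singleton s)
  have hsum : ∑' s, eta (D s) = 1 := by
    rw [← measure_iUnion _ hD]
    · rw [← Set.preimage_iUnion, Set.iUnion_of_singleton, Set.preimage_univ, measure_univ]
    · exact fun s t hst => Disjoint.preimage _ (by simpa using hst)
  have hle : ∀ s, eta (W ∩ D s) ≤ ((n : ENNReal) + 2)⁻¹ * eta (D s) := by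
    intro s
    rcases Set.eq_empty_or_nonempty (W ∩ D s) with h | ⟨ξ, hξ, rfl⟩
    · simp [h]
    · have h1 : D (initSeg n ξ) = cyl n ξ := preimage_initSeg n ξ
      -- Inside one cylinder, W fits into a single cylinder with one more edge, which has the
      -- fraction 1 / (n + 2) of its measure.
      have h2 : W ∩ D (initSeg n ξ) ⊆ cyl (n + 1) ξ := by
        rw [h1]
        rintro γ ⟨hγ, hγ'⟩ i hi
        rcases Nat.lt_succ_iff_lt_or_eq.1 hi with hi | rfl
        · exact hγ' i hi
        · exact hW γ hγ ξ hξ hγ'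
      refine (measure_mono h2).trans_eq ?_
      rw [h1, eta_cyl, eta_cyl, Nat.factorial_succ (n + 1), Nat.cast_mul,
        ENNReal.mul_inv (by simp) (by simp)]
      push_cast
      ring_nf
  calc eta W = eta (⋃ s, W ∩ D s) := by
        rw [← Set.inter_iUnion, ← Set.preimage_iUnion, Set.iUnion_of_singleton,
          Set.preimage_univ, Set.inter_univ]
    _ ≤ ∑' s, eta (W ∩ D s) := measure_iUnion_le _
    _ ≤ ∑' s, ((n : ENNReal) + 2)⁻¹ * eta (D s) := ENNReal.tsum_le_tsum hle
    _ = ((n : ENNReal) + 2)⁻¹ := by rw [ENNReal.tsum_mul_left, hsum, mul_one]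

/-! ### Cyclic shift of the rank -/

theorem exists_rankShift (n c : ℕ) (γ : Path) :
    ∃ ξ, TailEq n ξ γ ∧ rank ξ n = (rank γ n + c) % eul n (γ.vertex n) :=
  exists_tailEq_rank γ (Nat.mod_lt _ (eul_pos (γ.vertex_le n)))

/-- The path with the edges of `γ` from level `n` on whose rank at level `n` is that of `γ`
plus `c`, modulo the number of segments. -/
noncomputable def rankShift (n c : ℕ) (γ : Path) : Path := (exists_rankShift n c γ).choose

theorem rankShift_tailEq (n c : ℕ) (γ : Path) : TailEq n (rankShift n c γ) γ :=
  (exists_rankShift n c γ).choose_spec.1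

theorem rank_rankShift (n c : ℕ) (γ : Path) :
    rank (rankShift n c γ) n = (rank γ n + c) % eul n (γ.vertex n) :=
  (exists_rankShift n c γ).choose_spec.2

theorem exists_add_mod_eq {e r : ℕ} (c : ℕ) (hr : r < e) : ∃ j < e, (j + c) % e = r := by
  refine ⟨(r + (e - c % e)) % e, Nat.mod_lt _ (by omega), ?_⟩
  have := Nat.mod_lt c (show 0 < e by omega)
  rw [Nat.mod_add_mod, ← Nat.add_mod_mod, add_assoc, Nat.sub_add_cancel this.le,
    Nat.add_mod_right, Nat.mod_eq_of_lt hr]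

theorem add_mod_inj {e r s c : ℕ} (hr : r < e) (hs : s < e) (h : (r + c) % e = (s + c) % e) :
    r = s := by
  have : r ≡ s [MOD e] := Nat.ModEq.add_right_cancel' c h
  rwa [Nat.ModEq, Nat.mod_eq_of_lt hr, Nat.mod_eq_of_lt hs] at this

/-- Taking the rank modulo the number of segments makes the shift a permutation of the segments that
end at each vertex. -/
theorem measurePreserving_rankShift (n c : ℕ) : MeasurePreserving (rankShift n c) eta eta := by
  refine measurePreserving_of_tailEq n (fun ξ => ?_) (rankShift_tailEq n c) fun γ ξ hv => ?_
  · obtain ⟨j, hj, hjr⟩ := exists_add_mod_eq c (rank_lt ξ n)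
    obtain ⟨γ, ht, hr⟩ := exists_tailEq_rank ξ hj
    refine ⟨γ, ((rankShift_tailEq n c γ).trans ht).eq_of_rank_eq ?_⟩
    rw [rank_rankShift, hr, ht.vertex le_rfl, hjr]
  · refine ⟨fun h => mem_cyl_of_rank_eq hv ?_, fun h => mem_cyl_of_rank_eq ?_ ?_⟩
    · have := rank_eq_of_mem_cyl h
      rw [rank_rankShift, rank_rankShift, hv] at this
      have h1 := rank_lt γ n
      rw [hv] at h1
      exact add_mod_inj h1 (rank_lt ξ n) this
    · rw [(rankShift_tailEq n c γ).vertex le_rfl, (rankShift_tailEq n c ξ).vertex le_rfl, hv]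
    · rw [rank_rankShift, rank_rankShift, rank_eq_of_mem_cyl h, hv]

/-- A `T`-invariant set is invariant under changes of finitely many edges. -/
theorem TailEq.mem_iff {A : Set Path} (hA : T ⁻¹' A = A) {n : ℕ} {γ ξ : Path}
    (h : TailEq n γ ξ) : γ ∈ A ↔ ξ ∈ A := by
  have hit : ∀ c, T^[c] ⁻¹' A = A := fun c => by
    induction c with
    | zero => rfl
    | succ c ih => rw [Function.iterate_succ', Set.preimage_comp, hA, ih]
  have aux : ∀ {γ ξ : Path}, TailEq n γ ξ → rank γ n ≤ rank ξ n → (γ ∈ A ↔ ξ ∈ A) := by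
    intro γ ξ h hr
    have := T_iterate_eq_of_rank (c := rank ξ n - rank γ n) h.symm (by omega)
    rw [← this, ← Set.mem_preimage, hit]
  rcases le_total (rank γ n) (rank ξ n) with hr | hr
  · exact aux h hr
  · exact (aux h.symm hr).symm

/-! ### Rotation of parallel edges -/

theorem exists_edgeRot (n q : ℕ) (γ : Path) : ∃ ξ, TailEq (n + 1) ξ γ ∧ ξ ∈ cyl n γ ∧
    ξ.index n = (γ.index n + q) % mult n (γ.vertex n) (γ.vertex (n + 1)) := by
  have hx := γ.index_lt n
  obtain ⟨ζ, h1, h2, h3⟩ := exists_extend (n := n) (l := γ.vertex (n + 1))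
    (x := (γ.index n + q) % mult n (γ.vertex n) (γ.vertex (n + 1))) γ (Nat.mod_lt _ (by omega))
  obtain ⟨ξ, h4, h5⟩ := exists_splice h2
  refine ⟨ξ, h5, ?_, ?_⟩
  · rw [← cyl_eq_of_mem h1]; exact cyl_mono n.le_succ _ h4
  · rw [index_eq_of_mem_cyl h4 n.lt_succ_self, h3]

/-- Rotation by `q` of the edge from level `n` among the edges parallel to it. -/
noncomputable def edgeRot (n q : ℕ) (γ : Path) : Path := (exists_edgeRot n q γ).choose

theorem edgeRot_tailEq (n q : ℕ) (γ : Path) : TailEq (n + 1) (edgeRot n q γ) γ :=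
  (exists_edgeRot n q γ).choose_spec.1

theorem edgeRot_mem_cyl (n q : ℕ) (γ : Path) : edgeRot n q γ ∈ cyl n γ :=
  (exists_edgeRot n q γ).choose_spec.2.1

theorem index_edgeRot (n q : ℕ) (γ : Path) : (edgeRot n q γ).index n =
    (γ.index n + q) % mult n (γ.vertex n) (γ.vertex (n + 1)) :=
  (exists_edgeRot n q γ).choose_spec.2.2

theorem measurePreserving_edgeRot (n q : ℕ) : MeasurePreserving (edgeRot n q) eta eta := by
  refine measurePreserving_of_tailEq (n + 1) (fun ξ => ?_) (edgeRot_tailEq n q) fun γ ξ hv => ?_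
  · obtain ⟨j, hj, hjr⟩ := exists_add_mod_eq q (ξ.index_lt n)
    obtain ⟨ζ, h1, h2, h3⟩ := exists_extend ξ hj
    obtain ⟨γ, h4, h5⟩ := exists_splice h2
    have h6 : γ ∈ cyl n ξ := by
      rw [← cyl_eq_of_mem h1]; exact cyl_mono n.le_succ _ h4
    have h7 := edgeRot_mem_cyl n q γ
    refine ⟨γ, ((edgeRot_tailEq n q γ).trans h5).eq_of_mem_cyl (mem_cyl_succ_iff.2 ⟨?_, ?_, ?_⟩)⟩
    · rw [← cyl_eq_of_mem h6]; exact h7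
    · rw [(edgeRot_tailEq n q γ).vertex le_rfl, h5.vertex le_rfl]
    · rw [index_edgeRot, index_eq_of_mem_cyl h4 n.lt_succ_self, h3, h5.vertex le_rfl,
        vertex_eq_of_mem_cyl h6 le_rfl, hjr]
  · have hγ := edgeRot_mem_cyl n q γ
    have hξ := edgeRot_mem_cyl n q ξ
    have hc : edgeRot n q γ ∈ cyl n (edgeRot n q ξ) ↔ γ ∈ cyl n ξ := by
      rw [cyl_eq_of_mem hξ]
      constructor
      · intro h; rw [← cyl_eq_of_mem h, cyl_eq_of_mem hγ]; exact mem_cyl_self _ _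
      · intro h; rw [← cyl_eq_of_mem h]; exact hγ
    rw [mem_cyl_succ_iff, mem_cyl_succ_iff, hc, (edgeRot_tailEq n q γ).vertex le_rfl,
      (edgeRot_tailEq n q ξ).vertex le_rfl, index_edgeRot, index_edgeRot, hv]
    refine and_congr_right fun h => and_congr_right fun _ => ?_
    have hv' := vertex_eq_of_mem_cyl h le_rfl
    rw [hv']
    refine ⟨fun h' => ?_, fun h' => by rw [h']⟩
    have h1 := γ.index_lt n
    rw [hv', hv] at h1
    exact add_mod_inj h1 (ξ.index_lt n) h'

/-- The paths for which the edge from level `n` can be moved by `q` among its parallels. -/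
def movable (n q : ℕ) : Set Path :=
  {γ | γ.index n + q < mult n (γ.vertex n) (γ.vertex (n + 1))}

/-- A path that cannot be moved uses one of the last q edges in one of the two bundles leaving its
vertex. Each of these 2q choices determines the edge from the preceding ones. -/
theorem measure_compl_movable_le (n q : ℕ) :
    eta (movable n q)ᶜ ≤ 2 * q * ((n : ENNReal) + 2)⁻¹ := by
  -- The first coordinate selects the bundle, the second counts the parallel edges after the one
  -- used.
  let W : Fin 2 × Fin q → Set Path := fun p =>
    {γ | γ.vertex (n + 1) = γ.vertex n + p.1 ∧
      γ.index n + p.2 + 1 = mult n (γ.vertex n) (γ.vertex (n + 1))}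
  have hW : ∀ p, eta (W p) ≤ ((n : ENNReal) + 2)⁻¹ := by
    intro p
    refine measure_le_of_determined n fun γ hγ ξ hξ h => ?_
    have hv := vertex_eq_of_mem_cyl h le_rfl
    obtain ⟨h1, h2⟩ := hγ
    obtain ⟨h3, h4⟩ := hξ
    have hv' : γ.vertex (n + 1) = ξ.vertex (n + 1) := by omega
    rw [hv, hv'] at h2
    exact (γ.edge_eq_iff ξ n).2 ⟨hv, hv', by omega⟩
  have hsub : (movable n q)ᶜ ⊆ ⋃ p, W p := by
    intro γ hγ
    simp only [movable, Set.mem_compl_iff, Set.mem_ofPred_eq, not_lt] at hγ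
    have hx := γ.index_lt n
    have hlt : mult n (γ.vertex n) (γ.vertex (n + 1)) - γ.index n - 1 < q := by omega
    rw [Set.mem_iUnion]
    rcases γ.vertex_succ n with h | h
    · exact ⟨(0, ⟨_, hlt⟩), by simpa using h, by simp only; omega⟩
    · exact ⟨(1, ⟨_, hlt⟩), by simpa using h, by simp only; omega⟩
  calc eta (movable n q)ᶜ ≤ eta (⋃ p, W p) := measure_mono hsub
    _ ≤ ∑ p, eta (W p) := measure_iUnion_fintype_le _ _
    _ ≤ ∑ _p : Fin 2 × Fin q, ((n : ENNReal) + 2)⁻¹ := Finset.sum_le_sum fun p _ => hW p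
    _ = 2 * q * ((n : ENNReal) + 2)⁻¹ := by simp

theorem tendsto_error (q : ℕ) : Filter.Tendsto (fun n : ℕ => 2 * q * ((n : ENNReal) + 2)⁻¹)
    Filter.atTop (nhds 0) := by
  have h : Filter.Tendsto (fun n : ℕ => ((n : ENNReal) + 2)⁻¹) Filter.atTop (nhds 0) := by
    have := (Filter.tendsto_add_atTop_iff_nat 2).2 ENNReal.tendsto_inv_nat_nhds_zero
    simpa using this
  simpa using ENNReal.Tendsto.const_mul (a := 2 * (q : ENNReal)) h
    (Or.inr (ENNReal.mul_ne_top (by simp) (by simp)))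

/-- Moving the edge from level `n` by `q` is a power of `T`. -/
theorem edgeRot_eq_iterate {n q : ℕ} {γ : Path} (h : γ ∈ movable n q) :
    T^[q * eul n (γ.vertex n)] γ = edgeRot n q γ := by
  have hv := vertex_eq_of_mem_cyl (edgeRot_mem_cyl n q γ) le_rfl
  have hx := index_edgeRot n q γ
  rw [Nat.mod_eq_of_lt h] at hx
  refine T_iterate_eq_of_rank (edgeRot_tailEq n q γ) ?_
  simp only [rank, rank_eq_of_mem_cyl (edgeRot_mem_cyl n q γ), hv, hx,
    (edgeRot_tailEq n q γ).vertex le_rfl]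
  ring

/-! ### The adic transformation preserves the measure -/

/-- Moving the edge once raises the rank by a positive Eulerian number and still gives an admissible
rank, so the rank plus one, being no larger, is admissible too. -/
theorem rank_add_one_lt_of_movable {n : ℕ} {γ : Path} (h : γ ∈ movable n 1) :
    rank γ (n + 1) + 1 < eul (n + 1) (γ.vertex (n + 1)) := by
  have h1 := rank_lt (edgeRot n 1 γ) (n + 1)
  have hx := index_edgeRot n 1 γ
  rw [Nat.mod_eq_of_lt h] at hx
  simp only [rank, rank_eq_of_mem_cyl (edgeRot_mem_cyl n 1 γ),
    vertex_eq_of_mem_cyl (edgeRot_mem_cyl n 1 γ) le_rfl, hx,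
    (edgeRot_tailEq n 1 γ).vertex le_rfl, add_mul] at h1 ⊢
  have := eul_pos (γ.vertex_le n)
  omega

theorem T_eq_rankShift {n : ℕ} {γ : Path} (h : rank γ n + 1 < eul n (γ.vertex n)) :
    T γ = rankShift n 1 γ :=
  T_eq_of_rank (rankShift_tailEq n 1 γ) (by rw [rank_rankShift, Nat.mod_eq_of_lt h])

/-- The paths all of whose edges are maximal. -/
def maximalPaths : Set Path := {γ | ∀ n, rank γ n + 1 = eul n (γ.vertex n)}

/-- A step to the right would give a rank below `leftCount`. This is not maximal, because the new
vertex also receives edges from the right-hand source. -/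
theorem vertex_succ_of_mem_maximalPaths {γ : Path} (h : γ ∈ maximalPaths) {n : ℕ}
    (hn : γ.vertex n < n) : γ.vertex (n + 1) = γ.vertex n := by
  refine (γ.vertex_succ n).resolve_right fun hv => ?_
  have h1 := rank_lt_leftCount hv
  have h2 := h (n + 1)
  rw [eul_succ] at h2
  have := Nat.mul_pos (γ.vertex (n + 1)).succ_pos (eul_pos (show γ.vertex (n + 1) ≤ n by omega))
  simp only [Nat.succ_eq_add_one] at this
  omega

/-- A maximal path keeps to the right side forever or is eventually at a constant k; either
alternative, with k given, determines it, since vertex and maximal rank determine the segment. -/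
theorem countable_maximalPaths : maximalPaths.Countable := by
  have aux : ∀ γ ∈ maximalPaths, ∀ ξ ∈ maximalPaths, ∀ n, γ.vertex n = ξ.vertex n →
      γ ∈ cyl n ξ := fun γ hγ ξ hξ n hv => mem_cyl_of_rank_eq hv (by
    have h1 := hγ n
    have h2 := hξ n
    rw [hv] at h1
    omega)
  have hsub : maximalPaths ⊆ {γ ∈ maximalPaths | ∀ n, γ.vertex n = n} ∪
      ⋃ k, {γ ∈ maximalPaths | ∃ n, ∀ m, n ≤ m → γ.vertex m = k} := by
    intro γ hγ
    by_cases h : ∀ n, γ.vertex n = n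
    · exact Or.inl ⟨hγ, h⟩
    · push Not at h
      obtain ⟨n, hn⟩ := h
      refine Or.inr (Set.mem_iUnion.2 ⟨γ.vertex n, hγ, n, fun m hm => ?_⟩)
      have hn' := (γ.vertex_le n).lt_of_ne hn
      induction m, hm using Nat.le_induction with
      | base => rfl
      | succ m hm ih =>
        rw [vertex_succ_of_mem_maximalPaths hγ (by omega), ih]
  refine Set.Countable.mono hsub (Set.Countable.union ?_ (Set.countable_iUnion fun k => ?_))
  · refine Set.Subsingleton.countable ?_
    rintro γ ⟨hγ, h⟩ ξ ⟨hξ, h'⟩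
    exact Path.ext_edges fun i => aux γ hγ ξ hξ (i + 1) (by rw [h, h']) i i.lt_succ_self
  · refine Set.Subsingleton.countable ?_
    rintro γ ⟨hγ, n, h⟩ ξ ⟨hξ, m, h'⟩
    refine Path.ext_edges fun i => aux γ hγ ξ hξ (max (i + 1) (max n m)) ?_ i (by omega)
    rw [h _ (by omega), h' _ (by omega)]

instance : MeasurableSingletonClass Path :=
  inferInstanceAs (MeasurableSingletonClass
    {γ : ∀ n, Edge n // ∀ n, (γ n).target = (γ (n + 1)).source})

/-- Off the countable set of maximal paths, T agrees locally with a rank shift; the values chosen on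
that set do not matter. -/
theorem measurable_T : Measurable T := by
  intro B hB
  let U : ℕ → Set Path := fun n => {γ | rank γ n + 1 < eul n (γ.vertex n)}
  have hU : ∀ n, MeasurableSet (U n) := fun n => measurableSet_of_cyl n fun γ ξ h => by
    simp only [U, Set.mem_ofPred_eq, rank_eq_of_mem_cyl h, vertex_eq_of_mem_cyl h le_rfl]
  have : T ⁻¹' B = (⋃ n, U n ∩ rankShift n 1 ⁻¹' B) ∪ (maximalPaths ∩ T ⁻¹' B) := by
    ext γ
    simp only [Set.mem_union, Set.mem_iUnion, Set.mem_inter_iff, Set.mem_preimage]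
    constructor
    · intro h
      by_cases hγ : γ ∈ maximalPaths
      · exact Or.inr ⟨hγ, h⟩
      · simp only [maximalPaths, Set.mem_ofPred_eq, not_forall] at hγ
        obtain ⟨n, hn⟩ := hγ
        have hU : γ ∈ U n := lt_of_le_of_ne (rank_lt γ n) hn
        exact Or.inl ⟨n, hU, by rwa [← T_eq_rankShift hU]⟩
    · rintro (⟨n, hU, h⟩ | h)
      · rwa [T_eq_rankShift hU]
      · exact h.2
  rw [this]
  exact (MeasurableSet.iUnion fun n => (hU n).inter
    ((measurePreserving_rankShift n 1).measurable hB)).union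
    (countable_maximalPaths.mono Set.inter_subset_left).measurableSet

theorem measurePreserving_T : MeasurePreserving T eta eta := by
  have hle : ∀ B, MeasurableSet B → eta (T ⁻¹' B) ≤ eta B := by
    intro B hB
    have h : ∀ n : ℕ, eta (T ⁻¹' B) ≤ eta B + 2 * (1 : ℕ) * ((n : ENNReal) + 2)⁻¹ := by
      intro n
      have hsub : T ⁻¹' B ⊆ rankShift (n + 1) 1 ⁻¹' B ∪ (movable n 1)ᶜ := by
        intro γ hγ
        by_cases h : γ ∈ movable n 1
        · left
          rwa [Set.mem_preimage, ← T_eq_rankShift (rank_add_one_lt_of_movable h)]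
        · exact Or.inr h
      refine (measure_mono hsub).trans ((measure_union_le _ _).trans ?_)
      rw [(measurePreserving_rankShift (n + 1) 1).measure_preimage hB.nullMeasurableSet]
      gcongr
      exact measure_compl_movable_le n 1
    have ht := (tendsto_error 1).const_add (eta B)
    rw [add_zero] at ht
    exact ge_of_tendsto' ht h
  refine ⟨measurable_T, Measure.ext fun B hB => ?_⟩
  rw [Measure.map_apply measurable_T hB]
  refine le_antisymm (hle B hB) ?_
  -- For a probability measure, the inequality for the complement is the reverse inequality for the
  -- set.
  have h := hle Bᶜ hB.compl
  rw [Set.preimage_compl, prob_compl_eq_one_sub (measurable_T hB), prob_compl_eq_one_sub hB] at h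
  exact (ENNReal.sub_le_sub_iff_left prob_le_one ENNReal.one_ne_top).1 h

/-! ### Ergodicity of the adic transformation -/

theorem vertex_maxPath (k n : ℕ) : (maxPath k).vertex n = min n k := rfl

theorem eta_real_cyl (n : ℕ) (ξ : Path) : eta.real (cyl n ξ) = ((n + 1).factorial : ℝ)⁻¹ := by
  simp [Measure.real, eta_cyl]

theorem measure_inter_cyl_eq {A : Set Path} (hA : MeasurableSet A) (hT : T ⁻¹' A = A) {n : ℕ}
    {γ ξ : Path} (hv : γ.vertex n = ξ.vertex n) : eta (A ∩ cyl n γ) = eta (A ∩ cyl n ξ) := by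
  -- The shift by this c carries the segment of γ to that of ξ, and it preserves the invariant set.
  obtain ⟨c, _, hc⟩ := exists_add_mod_eq (rank γ n) (rank_lt ξ n)
  rw [add_comm] at hc
  have hpre : rankShift n c ⁻¹' (A ∩ cyl n ξ) = A ∩ cyl n γ := by
    ext α
    rw [Set.mem_preimage, Set.mem_inter_iff, Set.mem_inter_iff,
      (rankShift_tailEq n c α).mem_iff hT]
    refine and_congr_right fun _ => ⟨fun h => ?_, fun h => ?_⟩
    · have h1 := vertex_eq_of_mem_cyl h le_rfl
      rw [(rankShift_tailEq n c α).vertex le_rfl] at h1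
      have h2 := rank_eq_of_mem_cyl h
      rw [rank_rankShift, h1, ← hc] at h2
      have h3 := rank_lt α n
      have h4 := rank_lt γ n
      rw [h1] at h3
      rw [hv] at h4
      exact mem_cyl_of_rank_eq (h1.trans hv.symm) (add_mod_inj h3 h4 h2)
    · have h1 := (vertex_eq_of_mem_cyl h le_rfl).trans hv
      refine mem_cyl_of_rank_eq ?_ ?_
      · rw [(rankShift_tailEq n c α).vertex le_rfl, h1]
      · rw [rank_rankShift, h1, rank_eq_of_mem_cyl h, hc]
  rw [← hpre, (measurePreserving_rankShift n c).measure_preimage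
    (hA.inter (measurableSet_cyl n ξ)).nullMeasurableSet]

/-- The measure of the part of `A` in a cylinder that ends at the vertex `(n, k)`. -/
noncomputable def cylMeasure (A : Set Path) (n k : ℕ) : ℝ := eta.real (A ∩ cyl n (maxPath k))

section Invariant

variable {A : Set Path}

theorem eta_real_inter_cyl (hA : MeasurableSet A) (hT : T ⁻¹' A = A) (n : ℕ) (γ : Path) :
    eta.real (A ∩ cyl n γ) = cylMeasure A n (γ.vertex n) := by
  refine congrArg ENNReal.toReal (measure_inter_cyl_eq hA hT ?_)
  rw [vertex_maxPath, min_eq_right (γ.vertex_le n)]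

theorem cylMeasure_nonneg (n k : ℕ) : 0 ≤ cylMeasure A n k := measureReal_nonneg

theorem cylMeasure_le (n k : ℕ) : cylMeasure A n k ≤ ((n + 1).factorial : ℝ)⁻¹ := by
  rw [← eta_real_cyl n (maxPath k)]
  exact measureReal_mono Set.inter_subset_right

theorem cylMeasure_zero (k : ℕ) : cylMeasure A 0 k = eta.real A := by
  rw [cylMeasure, cyl_zero, Set.inter_univ]

theorem cylMeasure_succ (hA : MeasurableSet A) (hT : T ⁻¹' A = A) {n k : ℕ} (hk : k ≤ n) :
    cylMeasure A n k = ((k : ℝ) + 1) * cylMeasure A (n + 1) k +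
      ((n : ℝ) + 1 - k) * cylMeasure A (n + 1) (k + 1) := by
  have hv : (maxPath k).vertex n = k := by rw [vertex_maxPath, min_eq_right hk]
  have hex : ∀ p : (Σ b : Fin 2, Fin (mult n k (k + b))), ∃ ζ, ζ ∈ cyl n (maxPath k) ∧
      ζ.vertex (n + 1) = k + p.1 ∧ ζ.index n = p.2 := fun p =>
    exists_extend (maxPath k) (by rw [hv]; exact p.2.2)
  choose ζ h1 h2 h3 using hex
  have hunion : A ∩ cyl n (maxPath k) = ⋃ p, A ∩ cyl (n + 1) (ζ p) := by
    rw [← Set.inter_iUnion]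
    congr 1
    ext γ
    rw [Set.mem_iUnion]
    constructor
    · intro h
      have hγ := (vertex_eq_of_mem_cyl h le_rfl).trans hv
      have hx := γ.index_lt n
      have hb : ∃ b : Fin 2, γ.vertex (n + 1) = k + b := by
        rcases γ.vertex_succ n with h | h
        · exact ⟨0, by simp [h, hγ]⟩
        · exact ⟨1, by simp [h, hγ]⟩
      obtain ⟨b, hb⟩ := hb
      rw [hγ, hb] at hx
      refine ⟨⟨b, γ.index n, hx⟩, mem_cyl_succ_iff.2 ⟨?_, ?_, ?_⟩⟩
      · rw [cyl_eq_of_mem (h1 _)]; exact h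
      · rw [h2, hb]
      · rw [h3]
    · rintro ⟨p, hp⟩
      rw [← cyl_eq_of_mem (h1 p)]
      exact cyl_mono n.le_succ _ hp
  have hdisj : Pairwise (Function.onFun Disjoint fun p => A ∩ cyl (n + 1) (ζ p)) := by
    rintro ⟨b, x⟩ ⟨c, y⟩ hne
    refine Set.disjoint_left.2 fun γ hγ hγ' => hne ?_
    have e1 := vertex_eq_of_mem_cyl hγ.2 le_rfl
    have e2 := vertex_eq_of_mem_cyl hγ'.2 le_rfl
    have e3 := index_eq_of_mem_cyl hγ.2 n.lt_succ_self
    have e4 := index_eq_of_mem_cyl hγ'.2 n.lt_succ_self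
    rw [h2] at e1 e2
    rw [h3] at e3 e4
    obtain rfl : b = c := Fin.ext (by simp only at e1 e2; omega)
    obtain rfl : x = y := Fin.ext (by simp only at e3 e4; omega)
    rfl
  rw [cylMeasure, hunion, measureReal_iUnion_fintype hdisj
    fun p => hA.inter (measurableSet_cyl _ _)]
  simp only [eta_real_inter_cyl hA hT, h2, Fintype.sum_sigma, Fin.sum_univ_two, Finset.sum_const,
    Finset.card_univ, Fintype.card_fin, nsmul_eq_mul]
  simp only [Fin.val_zero, Fin.val_one, add_zero, mult_self, mult_succ]
  rw [Nat.cast_sub (by omega)]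
  push_cast
  ring

/-- By the recurrence, a difference at level n combines two differences at level n + 1 with
nonnegative weights k + 1 and n - k. Their sum is n + 1, one less than the number n + 2 of outgoing
edges, and this deficit, accumulated over j levels, gives the factor 1 / (n + j + 1). The case j = 0
is the trivial bound by the measure of a cylinder. -/
theorem abs_cylMeasure_sub_le (hA : MeasurableSet A) (hT : T ⁻¹' A = A) (j : ℕ) {n k : ℕ}
    (hk : k + 1 ≤ n) : |cylMeasure A n (k + 1) - cylMeasure A n k| ≤
      ((n.factorial : ℝ) * (n + j + 1))⁻¹ := by
  induction j generalizing n k with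
  | zero =>
    have h1 := cylMeasure_le (A := A) n k
    have h2 := cylMeasure_le (A := A) n (k + 1)
    have h3 := cylMeasure_nonneg (A := A) n k
    have h4 := cylMeasure_nonneg (A := A) n (k + 1)
    rw [Nat.factorial_succ, mul_comm] at h1 h2
    push_cast at h1 h2 ⊢
    rw [add_zero, abs_le]
    constructor <;> linarith
  | succ j ih =>
    rw [cylMeasure_succ hA hT hk, cylMeasure_succ hA hT (show k ≤ n by omega)]
    have h1 := ih (n := n + 1) (k := k) (by omega)
    have h2 := ih (n := n + 1) (k := k + 1) (by omega)
    have hkn : (k : ℝ) + 1 ≤ n := by exact_mod_cast hk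
    set a := cylMeasure A (n + 1) k
    set b := cylMeasure A (n + 1) (k + 1)
    set c := cylMeasure A (n + 1) (k + 1 + 1)
    set ε := (((n + 1).factorial : ℝ) * ((n + 1 : ℕ) + j + 1))⁻¹ with hε
    have hεn : ((n.factorial : ℝ) * (n + (j + 1 : ℕ) + 1))⁻¹ = (n + 1) * ε := by
      have : (n.factorial : ℝ) ≠ 0 := by positivity
      have : (n : ℝ) + 1 + j + 1 ≠ 0 := by positivity
      rw [hε, Nat.factorial_succ]
      push_cast
      rw [show (n : ℝ) + (j + 1) + 1 = n + 1 + j + 1 by ring]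
      field_simp
    rw [hεn]
    calc |((k + 1 : ℕ) + 1 : ℝ) * b + (n + 1 - (k + 1 : ℕ)) * c -
          ((k + 1) * a + (n + 1 - k) * b)|
        = |((k : ℝ) + 1) * (b - a) + (n - k) * (c - b)| := by push_cast; congr 1; ring
      _ ≤ ((k : ℝ) + 1) * |b - a| + (n - k) * |c - b| := by
        refine (abs_add_le _ _).trans_eq ?_
        rw [abs_mul, abs_mul, abs_of_nonneg (by positivity : (0 : ℝ) ≤ k + 1),
          abs_of_nonneg (by linarith : (0 : ℝ) ≤ n - k)]
      _ ≤ (k + 1) * ε + (n - k) * ε :=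
        add_le_add (mul_le_mul_of_nonneg_left h1 (by positivity))
          (mul_le_mul_of_nonneg_left h2 (by linarith))
      _ = (n + 1) * ε := by ring

theorem cylMeasure_eq_zero_vertex (hA : MeasurableSet A) (hT : T ⁻¹' A = A) {n k : ℕ}
    (hk : k ≤ n) : cylMeasure A n k = cylMeasure A n 0 := by
  induction k with
  | zero => rfl
  | succ k ih =>
    rw [← ih (by omega), ← sub_eq_zero, ← abs_nonpos_iff]
    have hlim : Filter.Tendsto (fun j : ℕ => ((n.factorial : ℝ) * (n + j + 1))⁻¹) Filter.atTop
        (nhds 0) := by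
      refine Filter.Tendsto.inv_tendsto_atTop (Filter.Tendsto.const_mul_atTop (by positivity) ?_)
      exact Filter.tendsto_atTop_add_const_right _ _
        (Filter.tendsto_atTop_add_const_left _ _ tendsto_natCast_atTop_atTop)
    exact ge_of_tendsto' hlim fun j => abs_cylMeasure_sub_le hA hT j hk

/-- Once the vertex is irrelevant, the recurrence reads a(n) = (n + 2) a(n + 1), as for the measures
of the cylinders themselves. -/
theorem cylMeasure_eq (hA : MeasurableSet A) (hT : T ⁻¹' A = A) {n k : ℕ} (hk : k ≤ n) :
    cylMeasure A n k = eta.real A * ((n + 1).factorial : ℝ)⁻¹ := by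
  rw [cylMeasure_eq_zero_vertex hA hT hk]
  clear hk
  induction n with
  | zero => simp [cylMeasure_zero]
  | succ n ih =>
    have h := cylMeasure_succ hA hT (Nat.zero_le n)
    rw [ih, cylMeasure_eq_zero_vertex hA hT (show 0 + 1 ≤ n + 1 by omega),
      Nat.cast_zero, sub_zero, zero_add, ← add_mul] at h
    rw [Nat.factorial_succ (n + 1)]
    have : (n : ℝ) + 2 ≠ 0 := by positivity
    push_cast
    rw [mul_inv, mul_left_comm, h]
    field_simp
    ring

theorem measure_inter_cyl (hA : MeasurableSet A) (hT : T ⁻¹' A = A) (n : ℕ) (ξ : Path) :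
    eta (A ∩ cyl n ξ) = eta A * eta (cyl n ξ) := by
  rw [← ENNReal.toReal_eq_toReal_iff' (measure_ne_top _ _)
    (ENNReal.mul_ne_top (measure_ne_top _ _) (measure_ne_top _ _)), ENNReal.toReal_mul]
  change eta.real _ = eta.real _ * eta.real _
  rw [eta_real_inter_cyl hA hT, cylMeasure_eq hA hT (ξ.vertex_le n), eta_real_cyl]

theorem measure_eq_zero_or_one (hA : MeasurableSet A) (hT : T ⁻¹' A = A) :
    eta A = 0 ∨ eta A = 1 := by
  -- Independence of A from cylinders extends to all measurable sets; evaluated at A itself it gives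
  -- a = a².
  have h : eta.restrict A = eta A • eta := measure_eq_of_cyl 0 (fun n ξ _ => by
    rw [Measure.restrict_apply (measurableSet_cyl n ξ), Set.inter_comm, measure_inter_cyl hA hT]
    rfl) (by simp)
  have h' := congrArg (fun μ => μ A) h
  simp only [Measure.restrict_apply hA, Set.inter_self, Measure.smul_apply, smul_eq_mul] at h'
  rcases eq_or_ne (eta A) 0 with h0 | h0
  · exact Or.inl h0
  · exact Or.inr ((ENNReal.eq_div_iff h0 (measure_ne_top _ _)).2 h'.symm |>.trans
      (ENNReal.div_self h0 (measure_ne_top _ _)))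

end Invariant

theorem ergodic_T : Ergodic T eta where
  toMeasurePreserving := measurePreserving_T
  aeconst_set A hA hT := by
    rw [Filter.eventuallyConst_set']
    rcases measure_eq_zero_or_one hA hT with h | h
    · exact Or.inl (ae_eq_empty.2 h)
    · exact Or.inr (ae_eq_univ.2 ((prob_compl_eq_zero_iff hA).2 h))

/-! ### Eulerian numbers modulo a prime -/

section PowerSeries

open PowerSeries

variable (R : Type*) [CommRing R]

/-- The generating function `∑ eul n k X ^ k`. -/
noncomputable def eulSeries (n : ℕ) : R⟦X⟧ := PowerSeries.mk fun k => (eul n k : R)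

/-- The series `∑ (k + 1) ^ (n + 1) X ^ k`. -/
noncomputable def powSeries (n : ℕ) : R⟦X⟧ := PowerSeries.mk fun k => ((k : R) + 1) ^ (n + 1)

theorem powSeries_zero_mul : powSeries R 0 * (1 - X) ^ 2 = 1 := by
  have h : powSeries R 0 * (1 - X) = PowerSeries.mk 1 := by
    ext k
    rw [mul_sub, mul_one, map_sub]
    cases k with
    | zero => simp [powSeries]
    | succ k => simp [powSeries, coeff_succ_mul_X]
  rw [pow_two, ← mul_assoc, h, mk_one_mul_one_sub_eq_one]

theorem eulSeries_zero : eulSeries R 0 = 1 := by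
  ext k
  cases k <;> simp [eulSeries, eul, coeff_one]

theorem powSeries_succ (n : ℕ) :
    powSeries R (n + 1) = powSeries R n + X * derivative R (powSeries R n) := by
  ext k
  cases k with
  | zero => simp [powSeries]
  | succ k =>
    simp [powSeries, coeff_succ_X_mul, coeff_derivative]
    ring

/-- The Eulerian recurrence as a differential equation: A(n+1) = A(n) + (n+1) X A(n) + X (1 - X)
A(n)'. -/
theorem eulSeries_succ (n : ℕ) : eulSeries R (n + 1) = eulSeries R n +
    X * (C ((n : R) + 1) * eulSeries R n) + X * (derivative R (eulSeries R n) -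
      X * derivative R (eulSeries R n)) := by
  ext k
  cases k with
  | zero => simp [eulSeries, eul]
  | succ k =>
    have h : ((eul (n + 1) (k + 1) : ℕ) : R) =
        ((n : R) + 1 - k) * eul n k + (k + 2) * eul n (k + 1) := by
      rcases le_or_gt k n with hk | hk
      · simp only [eul]
        push_cast [Nat.cast_sub (show k ≤ n + 1 by omega)]
        ring
      · simp [eul, eul_eq_zero hk, eul_eq_zero (show n < k + 1 by omega)]
    rw [map_add, map_add, coeff_succ_X_mul, coeff_C_mul, coeff_succ_X_mul]
    simp only [map_sub, coeff_derivative, eulSeries, coeff_mk, h]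
    cases k with
    | zero => simp; ring
    | succ k =>
      simp only [coeff_succ_X_mul, coeff_derivative, coeff_mk]
      push_cast
      ring

/-- Carlitz's identity. Multiplying by powers of 1 - X turns the operator F ↦ F + X F', which raises
the exponent in `powSeries`, into the Eulerian recurrence. -/
theorem eulSeries_eq (n : ℕ) : eulSeries R n = powSeries R n * (1 - X) ^ (n + 2) := by
  induction n with
  | zero => rw [eulSeries_zero, zero_add, powSeries_zero_mul]
  | succ n ih =>
    rw [eulSeries_succ, powSeries_succ, ih]
    have hd : derivative R ((1 - X : R⟦X⟧) ^ (n + 2)) =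
        -(((n : R⟦X⟧) + 2) * (1 - X) ^ (n + 1)) := by
      rw [derivative_pow, map_sub, derivative_one, derivative_X]
      push_cast
      simp
    have hC : (C ((n : R) + 1) : R⟦X⟧) = n + 1 := by simp
    rw [Derivation.leibniz, hd, hC, smul_eq_mul, smul_eq_mul]
    ring

/-- By Fermat, (k+1)^(p^j) = k+1 modulo p, so the power series collapses to 1 / (1 - X)^2 and the
Eulerian series to (1 - X)^n. Times 1 - X this is 1 - X^(n+1) by Frobenius, so all coefficients up
to n are 1. -/
theorem eul_modEq_one {p j n k : ℕ} [Fact p.Prime] (hn : n + 1 = p ^ j) (hk : k ≤ n) :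
    eul n k ≡ 1 [MOD p] := by
  have hpow : powSeries (ZMod p) n = powSeries (ZMod p) 0 := by
    ext k
    simp only [powSeries, coeff_mk, hn, ZMod.pow_card_pow, zero_add, pow_one]
  have : CharP (ZMod p)⟦X⟧ p := charP_of_injective_ringHom (C_injective (R := ZMod p)) p
  have h : eulSeries (ZMod p) n * (1 - X) = 1 - X ^ (n + 1) := by
    rw [eulSeries_eq, hpow, add_comm n 2, pow_add, ← mul_assoc, powSeries_zero_mul, one_mul,
      ← pow_succ, hn, sub_pow_char_pow, one_pow]
  rw [← ZMod.natCast_eq_natCast_iff, Nat.cast_one]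
  induction k with
  | zero =>
    have := congrArg (coeff 0) h
    simpa [eulSeries] using this
  | succ k ih =>
    have := congrArg (coeff (k + 1)) h
    rw [mul_sub, mul_one, map_sub, map_sub, coeff_succ_mul_X, coeff_X_pow, if_neg (by omega),
      coeff_one, if_neg (by omega), sub_zero, sub_eq_zero] at this
    simp only [eulSeries, coeff_mk] at this
    rw [this, ih (by omega)]

end PowerSeries

/-! ### Total ergodicity -/

/-- For n = p^j - 1 ≥ N the edge rotation stays in the given cylinder and, where it is a power of T,
lands in A exactly when T^q does. The exceptional set vanishes as j grows. -/
theorem measure_preimage_inter_cyl_le {p q : ℕ} (hp : p.Prime) {A : Set Path}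
    (hA : MeasurableSet A) (hT : T^[p * q] ⁻¹' A = A) (N : ℕ) (ξ : Path) :
    eta (T^[q] ⁻¹' A ∩ cyl N ξ) ≤ eta (A ∩ cyl N ξ) := by
  have : Fact p.Prime := ⟨hp⟩
  have hit : ∀ t, T^[p * q * t] ⁻¹' A = A := fun t => by
    induction t with
    | zero => rfl
    | succ t ih => rw [Nat.mul_succ, Function.iterate_add, Set.preimage_comp, ih, hT]
  have hle : ∀ j, N ≤ p ^ j - 1 → eta (T^[q] ⁻¹' A ∩ cyl N ξ) ≤
      eta (A ∩ cyl N ξ) + 2 * q * (((p ^ j - 1 : ℕ) : ENNReal) + 2)⁻¹ := by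
    intro j hj
    have hn : p ^ j - 1 + 1 = p ^ j := Nat.sub_add_cancel (Nat.pow_pos hp.pos)
    set n := p ^ j - 1
    have hsub : T^[q] ⁻¹' A ∩ cyl N ξ ⊆ edgeRot n q ⁻¹' (A ∩ cyl N ξ) ∪ (movable n q)ᶜ := by
      rintro γ ⟨hγ, hc⟩
      by_cases hm : γ ∈ movable n q
      · refine Or.inl ⟨?_, ?_⟩
        · have hmod := eul_modEq_one (p := p) hn (γ.vertex_le n)
          obtain ⟨t, ht⟩ := (Nat.modEq_iff_dvd' (eul_pos (γ.vertex_le n))).1 hmod.symm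
          have he : eul n (γ.vertex n) = p * t + 1 := by
            have := eul_pos (γ.vertex_le n)
            omega
          -- The exponent is q modulo pq, and A absorbs multiples of pq.
          rw [← edgeRot_eq_iterate hm, he, show q * (p * t + 1) = p * q * t + q by ring,
            Function.iterate_add_apply, ← Set.mem_preimage, hit]
          exact hγ
        · rw [← cyl_eq_of_mem hc]
          exact cyl_mono hj γ (edgeRot_mem_cyl n q γ)
      · exact Or.inr hm
    refine (measure_mono hsub).trans ((measure_union_le _ _).trans ?_)
    rw [(measurePreserving_edgeRot n q).measure_preimage
      (hA.inter (measurableSet_cyl N ξ)).nullMeasurableSet]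
    gcongr
    exact measure_compl_movable_le n q
  have hlim : Filter.Tendsto (fun j => p ^ j - 1) Filter.atTop Filter.atTop :=
    (Filter.tendsto_sub_atTop_nat 1).comp (tendsto_pow_atTop_atTop_of_one_lt hp.one_lt)
  have ht := ((tendsto_error q).comp hlim).const_add (eta (A ∩ cyl N ξ))
  rw [add_zero] at ht
  exact ge_of_tendsto ht ((hlim.eventually_ge_atTop N).mono hle)

theorem measure_preimage_inter_cyl {p q : ℕ} (hp : p.Prime) {A : Set Path}
    (hA : MeasurableSet A) (hT : T^[p * q] ⁻¹' A = A) (N : ℕ) (ξ : Path) :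
    eta (T^[q] ⁻¹' A ∩ cyl N ξ) = eta (A ∩ cyl N ξ) := by
  have hB := (measurable_T.iterate q) hA
  refine le_antisymm (measure_preimage_inter_cyl_le hp hA hT N ξ) ?_
  -- The complement satisfies the same invariance, which yields the reverse inequality.
  have h := measure_preimage_inter_cyl_le hp hA.compl (by rw [Set.preimage_compl, hT]) N ξ
  have h1 := measure_inter_add_sdiff (μ := eta) (cyl N ξ) hA
  have h2 := measure_inter_add_sdiff (μ := eta) (cyl N ξ) hB
  rw [Set.preimage_compl, Set.inter_comm, ← Set.sdiff_eq, Set.inter_comm, ← Set.sdiff_eq] at h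
  rw [Set.inter_comm A, Set.inter_comm _ (cyl N ξ)]
  refine (ENNReal.add_le_add_iff_right (measure_ne_top eta (cyl N ξ \ A))).1 ?_
  rw [h1, ← h2]
  gcongr

theorem preimage_iterate_ae_eq {p q : ℕ} (hp : p.Prime) {A : Set Path}
    (hA : MeasurableSet A) (hT : T^[p * q] ⁻¹' A = A) : T^[q] ⁻¹' A =ᵐ[eta] A := by
  have hB := (measurable_T.iterate q) hA
  -- Equal mass in every cylinder makes the two restrictions equal as measures, so each set is null
  -- outside the other.
  have h : eta.restrict (T^[q] ⁻¹' A) = eta.restrict A := by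
    have hc : ∀ n ξ, eta.restrict (T^[q] ⁻¹' A) (cyl n ξ) = eta.restrict A (cyl n ξ) := by
      intro n ξ
      rw [Measure.restrict_apply (measurableSet_cyl n ξ),
        Measure.restrict_apply (measurableSet_cyl n ξ), Set.inter_comm,
        measure_preimage_inter_cyl hp hA hT, Set.inter_comm]
    exact measure_eq_of_cyl 0 (fun n ξ _ => hc n ξ) (by
      simpa only [cyl_zero] using hc 0 (maxPath 0))
  refine Filter.EventuallyLE.antisymm ?_ ?_
  · rw [ae_le_set, Set.sdiff_eq, Set.inter_comm, ← Measure.restrict_apply hA.compl, h,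
      Measure.restrict_apply hA.compl, Set.compl_inter_self, measure_empty]
  · rw [ae_le_set, Set.sdiff_eq, Set.inter_comm, ← Measure.restrict_apply hB.compl, ← h,
      Measure.restrict_apply hB.compl, Set.compl_inter_self, measure_empty]

theorem ergodic_iterate {n : ℕ} (hn : 0 < n) : Ergodic T^[n] eta := by
  induction n using induction_on_primes with
  | zero => omega
  | one => exact ergodic_T
  | prime_mul p q hp ih =>
    have hq := ih (Nat.pos_of_mul_pos_left hn)
    refine ⟨measurePreserving_T.iterate _, ⟨fun A hA hT => ?_⟩⟩
    -- A set invariant under T^(pq) is almost everywhere invariant under T^q, whose ergodicity is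
    -- the induction hypothesis.
    exact hq.quasiErgodic.aeconst_set₀ hA.nullMeasurableSet (preimage_iterate_ae_eq hp hA hT)

theorem IsEigenvalue.eq_one {z : ℂ} {m : ℕ} (hm : 0 < m) (hz : z ^ m = 1)
    (h : IsEigenvalue T eta z) : z = 1 := by
  obtain ⟨f, hf, hne, hfz⟩ := h
  have hit : ∀ c : ℕ, f ∘ T^[c] =ᵐ[eta] fun x => z ^ c * f x := by
    intro c
    induction c with
    | zero => simp
    | succ c ih =>
      have h1 := measurePreserving_T.quasiMeasurePreserving.ae_eq_comp ih
      filter_upwards [h1, hfz] with x h1 h2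
      simp only [Function.comp_apply] at h1 ⊢
      rw [Function.iterate_succ_apply, h1, h2, pow_succ, mul_assoc]
  have hinv : f ∘ T^[m] =ᵐ[eta] f := by simpa [hz] using hit m
  obtain ⟨c, hc⟩ := (ergodic_iterate hm).ae_eq_const_of_ae_eq_comp_ae hf hinv
  have hc' := measurePreserving_T.quasiMeasurePreserving.ae_eq_comp hc
  have hc0 : c ≠ 0 := by
    rintro rfl
    exact hne hc
  -- At almost every point f(x) = c, f(T x) = c and f(T x) = z f(x), so c = z c with c nonzero.
  obtain ⟨x, h1, h2, h3⟩ := (hc.and (hc'.and hfz)).exists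
  simp only [Function.comp_apply, Function.const_apply] at h1 h2
  change f (T x) = z * f x at h3
  rw [h1, h2] at h3
  exact mul_right_cancel₀ hc0 (by rw [one_mul]; exact h3.symm)

end EulerAdic

theorem mainTheorem7 :
    (∀ n : ℕ, 0 < n → Ergodic (EulerAdic.T^[n]) EulerAdic.eta) ∧
      ∀ z : ℂ, (∃ m : ℕ, 0 < m ∧ z ^ m = 1) →
        EulerAdic.IsEigenvalue EulerAdic.T EulerAdic.eta z → z = 1 :=
  ⟨fun _ hn => EulerAdic.ergodic_iterate hn, fun _ ⟨_, hm, hz⟩ h => h.eq_one hm hz⟩
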